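/- Let $k$ be an algebraically closed field, let $A$ and $B$ be finite-dimensional associative unital $k$-algebras (for example bound quiver algebras), let $T$ be a finite-dimensional $A$-$B$-bimodule on which $k$ acts centrally, let $Z$ be a variety over $k$ (a reduced separated scheme of finite type over $k$, not necessarily irreducible; $z\in Z$ means a closed point), and let $n\ge 0$ be an integer. A family of $A$-modules over $Z$ is a collection $(V_z)_{z\in Z}$ of finite-dimensional left $A$-modules together with a structure of algebraic vector bundle over $Z$ of constant rank with fibres $V_z$, such that for each $a\in A$ the map $z\mapsto (a\cdot\colon V_z\to V_z)$ is a regular section of the endomorphism bundle $(\operatorname{End}_k(V_z))_{z\in Z}$. Families of $B$-modules are defined in the same way. (1) Let $(V_z)_{z\in Z}$ be a family of $A$-modules and suppose that for each $0\le l\le n$ there is an integer $m_l$ with $\dim_k\operatorname{Ext}^l_A(T,V_z)=m_l$ for all $z\in Z$. Then $(\operatorname{Ext}^n_A(T,V_z))_{z\in Z}$, where $B$ acts through its right action on $T$, is a family of $B$-modules. More precisely, it has a structure of family of $B$-modules such that, for every resolution $P_\bullet\to T$ by finitely generated projective left $A$-modules, the regular sections over an open set $U\subseteq Z$ are exactly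 the families $(s_z)_{z\in U}$ which locally on $U$ have the form $s_z=[f_z]$ with cocycles $f_z\in\operatorname{Hom}_A(P_n,V_z)$ such that $z\mapsto f_z(x)$ is a regular section of $(V_z)$ for every $x\in P_n$. (2) Let $(W_z)_{z\in Z}$ be a family of $B$-modules and suppose that for each $0\le l\le n$ there is an integer $t_l$ with $\dim_k\operatorname{Tor}_l^B(T,W_z)=t_l$ for all $z\in Z$. Then $(\operatorname{Tor}_n^B(T,W_z))_{z\in Z}$, where $A$ acts through its left action on $T$, is a family of $A$-modules. More precisely, it has a structure of family of $A$-modules such that, for every resolution $P_\bullet\to T$ by finitely generated projective right $B$-modules, the regular sections over an open set $U\subseteq Z$ are exactly the families $(s_z)_{z\in U}$ which locally on $U$ have the form $s_z=[c_z]$ with cycles $c_z=\sum_j x_j\otimes t_j(z)\in P_n\otimes_B W_z$ (a finite sum), where the $x_j\in P_n$ do not depend on $z$ and the $t_j$ are regular sections of $(W_z)$. -/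

import Mathlib

open CategoryTheory AlgebraicGeometry TensorProduct

universe u

noncomputable section

/-! ### Regular functions on a variety

`Z` is a scheme of finite type over the algebraically closed field `k`, with structure morphism `p`.
The points `z ∈ Z` of the classical variety are the closed points of the scheme, and the residue
field at each of them is `k`. -/

section Regular

variable {k : Type u} [Field k] [IsAlgClosed k] {Z : Scheme.{u}} (p : Z ⟶ Spec (.of k))
  [LocallyOfFiniteType p]

/-- The value `s(z) ∈ k` at a closed point `z ∈ U` of a section `s` of `𝒪_Z` over `U`. -/
def sectionValue {U : Z.Opens} (s : Γ(Z, U)) (z : closedPoints Z) (hz : z.1 ∈ U) : k :=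
  (residueFieldIsoBase p z.1 z.2).hom (Z.evaluation U z.1 hz s)

/-- `f` is a regular function on the open set `U`: locally on `U` it is given by the values of
sections of `𝒪_Z`. The values of `f` outside `U` play no role. -/
def IsRegularOn (U : Z.Opens) (f : closedPoints Z → k) : Prop :=
  ∀ z : closedPoints Z, z.1 ∈ U → ∃ W : Z.Opens, W ≤ U ∧ z.1 ∈ W ∧
    ∃ s : Γ(Z, W), ∀ (w : closedPoints Z) (hw : w.1 ∈ W), sectionValue p s w hw = f w

end Regular

/-! ### Vector bundles and families of modules -/

section Bundles

variable {k : Type u} [Field k] [IsAlgClosed k] {Z : Scheme.{u}} (p : Z ⟶ Spec (.of k))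
  [LocallyOfFiniteType p]

/-- The structure of an algebraic vector bundle (of constant rank) over `Z` on a collection
`(V_z)` of vector spaces, given by an open cover with local frames whose transition matrices are
regular. The bases `frame i z` matter only for `z ∈ chart i`; their values at the other points
are never used (all the `V_z` have dimension `rank`, so they can always be filled in). -/
structure AlgVectorBundle (V : closedPoints Z → Type u)
    [∀ z, AddCommGroup (V z)] [∀ z, Module k (V z)] where
  rank : ℕ
  index : Type u
  chart : index → Z.Opens
  covers : ∀ z : closedPoints Z, ∃ i, z.1 ∈ chart i
  frame : index → ∀ z : closedPoints Z, Module.Basis (Fin rank) k (V z)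
  transition : ∀ (i j : index) (a b : Fin rank),
    IsRegularOn p (chart i ⊓ chart j) (fun z => (frame j z).repr (frame i z a) b)

/-- `s` is a regular section over `U`: its coordinates in the local frames are regular functions.
The values of `s` outside `U` play no role. -/
def AlgVectorBundle.IsRegularSection {p : Z ⟶ Spec (.of k)} [LocallyOfFiniteType p]
    {V : closedPoints Z → Type u} [∀ z, AddCommGroup (V z)] [∀ z, Module k (V z)]
    (E : AlgVectorBundle p V) (U : Z.Opens) (s : ∀ z, V z) : Prop :=
  ∀ (i : E.index) (a : Fin E.rank),
    IsRegularOn p (U ⊓ E.chart i) (fun z => (E.frame i z).repr (s z) a)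

/-- The structure of a family of `A`-modules over `Z` on a collection `(V_z)` of `A`-modules:
an algebraic vector bundle structure such that, for each `a ∈ A`, the map sending `z` to the
multiplication by `a` on `V_z` is a regular section of the endomorphism bundle, i.e. has regular
matrix entries in the local frames. -/
structure ModuleFamily (A : Type u) [Ring A] [Algebra k A] (V : closedPoints Z → Type u)
    [∀ z, AddCommGroup (V z)] [∀ z, Module k (V z)] [∀ z, Module A (V z)]
    [∀ z, IsScalarTower k A (V z)] extends AlgVectorBundle p V where
  action : ∀ (a : A) (i : index) (b c : Fin rank),
    IsRegularOn p (chart i) (fun z => (frame i z).repr (a • frame i z b) c)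

end Bundles

/-! ### `Ext_A^n(T, M)` as a left `B`-module -/

section ExtModule

/-- The scalar multiplication on morphisms of a `k`-linear category. -/
abbrev linearSMul {k : Type*} [Semiring k] {C : Type*} [Category* C] [Preadditive C] [Linear k C]
    {X Y : C} (c : k) (f : X ⟶ Y) : X ⟶ Y := c • f

/-- The vector space `Ext_A^n(T, M)`. The argument `B` only records which algebra acts on it. -/
@[nolint unusedArguments]
def ExtMod (A _B T M : Type u) [Ring A] [AddCommGroup T] [Module A T] [AddCommGroup M] [Module A M]
    (n : ℕ) : Type u :=
  Abelian.Ext (ModuleCat.of A T) (ModuleCat.of A M) n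

variable (k A B T M : Type u) [Field k] [Ring A] [Algebra k A] [Ring B]
  [AddCommGroup T] [Module A T] [Module Bᵐᵒᵖ T] [SMulCommClass A Bᵐᵒᵖ T]
  [AddCommGroup M] [Module A M] (n : ℕ)

instance : AddCommGroup (ExtMod A B T M n) :=
  inferInstanceAs (AddCommGroup (Abelian.Ext (ModuleCat.of A T) (ModuleCat.of A M) n))

instance : Module k (ExtMod A B T M n) :=
  inferInstanceAs (Module k (Abelian.Ext (ModuleCat.of A T) (ModuleCat.of A M) n))

variable {B} in
/-- Right multiplication by `b` on an `A`-`B`-bimodule, an endomorphism of the `A`-module `T`. -/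
def rightMulHom (b : B) : ModuleCat.of A T ⟶ ModuleCat.of A T :=
  haveI : SMulCommClass Bᵐᵒᵖ A T := SMulCommClass.symm _ _ _
  ModuleCat.ofHom (DistribSMul.toLinearMap A T (MulOpposite.op b))

variable {B} in
/-- The endomorphism of `Ext_A^n(T, M)` induced by right multiplication by `b` on `T`. -/
def extAction (b : B) (x : Abelian.Ext (ModuleCat.of A T) (ModuleCat.of A M) n) :
    Abelian.Ext (ModuleCat.of A T) (ModuleCat.of A M) n :=
  (Abelian.Ext.mk₀ (rightMulHom A T b)).comp x (zero_add n)

lemma extAction_one (x) : extAction A T M n (1 : B) x = x := by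
  have : rightMulHom A T (1 : B) = 𝟙 _ := by
    ext t; exact one_smul Bᵐᵒᵖ t
  rw [extAction, this, Abelian.Ext.mk₀_id_comp]

lemma extAction_mul (b c : B) (x) :
    extAction A T M n (b * c) x = extAction A T M n b (extAction A T M n c x) := by
  have : rightMulHom A T (b * c) = rightMulHom A T b ≫ rightMulHom A T c := by
    ext t; exact mul_smul (MulOpposite.op c) (MulOpposite.op b) t
  rw [extAction, this, extAction, extAction, Abelian.Ext.mk₀_comp_mk₀_assoc]

lemma extAction_add (b c : B) (x) :
    extAction A T M n (b + c) x = extAction A T M n b x + extAction A T M n c x := by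
  have : rightMulHom A T (b + c) = rightMulHom A T b + rightMulHom A T c := by
    ext t; exact add_smul (MulOpposite.op b) (MulOpposite.op c) t
  rw [extAction, this, Abelian.Ext.mk₀_add, Abelian.Ext.add_comp, extAction, extAction]

lemma extAction_zero (x) : extAction A T M n (0 : B) x = 0 := by
  have : rightMulHom A T (0 : B) = 0 := by
    ext t; exact zero_smul Bᵐᵒᵖ t
  rw [extAction, this, Abelian.Ext.mk₀_zero, Abelian.Ext.zero_comp]

/-- `B` acts on `Ext_A^n(T, M)` through its right action on `T`, by functoriality. -/
instance : Module B (ExtMod A B T M n) where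
  smul b x := extAction A T M n b x
  one_smul x := extAction_one A B T M n x
  mul_smul b c x := extAction_mul A B T M n b c x
  smul_zero b := Abelian.Ext.comp_zero (Abelian.Ext.mk₀ (rightMulHom A T b)) _ n n (zero_add n)
  smul_add b x y := Abelian.Ext.comp_add (Abelian.Ext.mk₀ (rightMulHom A T b)) x y (zero_add n)
  add_smul b c x := extAction_add A B T M n b c x
  zero_smul x := extAction_zero A B T M n x

variable [Algebra k B] [Module k T] [IsScalarTower k A T] [IsScalarTower k Bᵐᵒᵖ T]

lemma extAction_smul (c : k) (b : B) (x) :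
    extAction A T M n (c • b) x = c • extAction A T M n b x := by
  have : rightMulHom A T (c • b) = linearSMul c (rightMulHom A T b) := by
    ext t
    change MulOpposite.op (c • b) • t = (algebraMap k A c) • (MulOpposite.op b • t)
    rw [MulOpposite.op_smul, smul_assoc, algebraMap_smul]
  rw [extAction, this, Abelian.Ext.mk₀_smul, Abelian.Ext.smul_comp, extAction]

instance : IsScalarTower k B (ExtMod A B T M n) where
  smul_assoc c b x := extAction_smul k A B T M n c b x

end ExtModule

/-! ### The tensor product over a noncommutative algebra -/

section Tensor

variable (k B : Type u) [Field k] [Ring B] [Algebra k B]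

/-- The relations `x b ⊗ w - x ⊗ b w` in `N ⊗_k W`. -/
def balancedRelations (N W : Type u) [AddCommGroup N] [Module k N] [Module Bᵐᵒᵖ N]
    [AddCommGroup W] [Module k W] [Module B W] : Submodule k (N ⊗[k] W) :=
  Submodule.span k {y | ∃ (b : B) (x : N) (w : W),
    y = (MulOpposite.op b • x) ⊗ₜ[k] w - x ⊗ₜ[k] (b • w)}

/-- `N ⊗_B W` for a right `B`-module `N` and a left `B`-module `W`. -/
abbrev BalancedTensor (N W : Type u) [AddCommGroup N] [Module k N] [Module Bᵐᵒᵖ N]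
    [AddCommGroup W] [Module k W] [Module B W] : Type u :=
  (N ⊗[k] W) ⧸ balancedRelations k B N W

open scoped ModuleCat

variable (W : Type u) [AddCommGroup W] [Module k W] [Module B W]

variable {k B} in
/-- A map of right `B`-modules, as a `k`-linear map. -/
def underlyingLinearMap {N N' : ModuleCat.{u} Bᵐᵒᵖ} (f : N ⟶ N') : N →ₗ[k] N' :=
  f.hom.restrictScalars k

variable {k B W} in
lemma balancedTensor_hom_ext {N : ModuleCat.{u} Bᵐᵒᵖ} {X : ModuleCat.{u} k}
    {f g : ModuleCat.of k (BalancedTensor k B N W) ⟶ X}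
    (h : ∀ (x : N) (w : W), f.hom (Submodule.Quotient.mk (x ⊗ₜ[k] w)) =
      g.hom (Submodule.Quotient.mk (x ⊗ₜ[k] w))) : f = g :=
  ModuleCat.hom_ext <| Submodule.linearMap_qext _ <| TensorProduct.ext' h

/-- The functor `- ⊗_B W` from right `B`-modules to `k`-vector spaces. -/
def tensorFunctor : ModuleCat.{u} Bᵐᵒᵖ ⥤ ModuleCat.{u} k where
  obj N := ModuleCat.of k (BalancedTensor k B N W)
  map f := ModuleCat.ofHom <|
    Submodule.mapQ _ _ ((underlyingLinearMap (k := k) f).rTensor W) <| by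
      refine Submodule.span_le.2 ?_
      rintro _ ⟨b, x, w, rfl⟩
      refine Submodule.subset_span ⟨b, f x, w, ?_⟩
      simp [underlyingLinearMap]
  map_id _ := balancedTensor_hom_ext fun _ _ => rfl
  map_comp f g := balancedTensor_hom_ext fun _ _ => rfl

instance : (tensorFunctor k B W).Additive where
  map_add {_ N' f g} := balancedTensor_hom_ext fun x w =>
    congrArg (Submodule.Quotient.mk (p := balancedRelations k B N' W))
      (TensorProduct.add_tmul (R := k) (f x) (g x) w)

instance : (tensorFunctor k B W).Linear k where
  map_smul {_ N'} f c := balancedTensor_hom_ext fun x w =>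
    congrArg (Submodule.Quotient.mk (p := balancedRelations k B N' W))
      (TensorProduct.smul_tmul' (R := k) c (f x) w).symm

/-- The class of `x ⊗ w` in `N ⊗_B W`. -/
def balancedTmul (N : ModuleCat.{u} Bᵐᵒᵖ) (x : N) (w : W) : (tensorFunctor k B W).obj N :=
  Submodule.Quotient.mk (x ⊗ₜ[k] w)

end Tensor

/-! ### Left derived functors of linear functors -/

section LeftDerived

variable {k : Type u} [Field k] {C D : Type*} [Category* C] [Category* D] [Abelian C]
  [HasProjectiveResolutions C] [Abelian D] [Linear k C] [Linear k D] (F : C ⥤ D) [F.Additive]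
  (n : ℕ)

instance leftDerived_additive : (F.leftDerived n).Additive where
  map_add {X Y f g} := by
    let P := projectiveResolution X
    let Q := projectiveResolution Y
    have h : (ProjectiveResolution.lift f P Q + ProjectiveResolution.lift g P Q) ≫ Q.π =
        P.π ≫ (ChainComplex.single₀ C).map (f + g) := by
      rw [Preadditive.add_comp, ProjectiveResolution.lift_commutes,
        ProjectiveResolution.lift_commutes, Functor.map_add, Preadditive.comp_add]
    rw [F.leftDerived_map_eq n (f + g) _ h,
      F.leftDerived_map_eq n f _ (ProjectiveResolution.lift_commutes f P Q),
      F.leftDerived_map_eq n g _ (ProjectiveResolution.lift_commutes g P Q),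
      Functor.map_add, Preadditive.add_comp, Preadditive.comp_add]

instance leftDerived_linear [F.Linear k] : (F.leftDerived n).Linear k where
  map_smul {X Y} f c := by
    let P := projectiveResolution X
    let Q := projectiveResolution Y
    have h₀ : (ChainComplex.single₀ C).map (c • f) = c • (ChainComplex.single₀ C).map f := by
      ext
      rw [HomologicalComplex.smul_f_apply]
      erw [ChainComplex.single₀_map_f_zero, ChainComplex.single₀_map_f_zero]
      rfl
    have h : (c • ProjectiveResolution.lift f P Q) ≫ Q.π =
        P.π ≫ (ChainComplex.single₀ C).map (c • f) := by
      rw [h₀, Linear.smul_comp, Linear.comp_smul, ProjectiveResolution.lift_commutes]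
    rw [F.leftDerived_map_eq n (c • f) _ h,
      F.leftDerived_map_eq n f _ (ProjectiveResolution.lift_commutes f P Q)]
    have h' (K L : ChainComplex D ℕ) (φ : K ⟶ L) :
        (HomologicalComplex.homologyFunctor D _ n).map (c • φ) =
          c • (HomologicalComplex.homologyFunctor D _ n).map φ :=
      ShortComplex.homologyMap_smul
        (φ := (HomologicalComplex.shortComplexFunctor D _ n).map φ) c
    rw [Functor.comp_map, Functor.map_smul, h', Linear.smul_comp, Linear.comp_smul,
      Functor.comp_map]

end LeftDerived

/-! ### `Tor_n^B(T, W)` as a left `A`-module -/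

section TorModule

variable (k A B T W : Type u) [Field k] [Ring A] [Ring B] [Algebra k B]
  [AddCommGroup T] [Module A T] [Module Bᵐᵒᵖ T] [SMulCommClass A Bᵐᵒᵖ T]
  [AddCommGroup W] [Module k W] [Module B W] (n : ℕ)

/-- The vector space `Tor_n^B(T, W)`: the `n`-th left derived functor of `- ⊗_B W`, at `T`.
The argument `A` only records which algebra acts on it. -/
@[nolint unusedArguments]
def TorMod (k _A B T W : Type u) [Field k] [Ring B] [Algebra k B] [AddCommGroup T] [Module Bᵐᵒᵖ T]
    [AddCommGroup W] [Module k W] [Module B W] (n : ℕ) : Type u :=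
  ((tensorFunctor k B W).leftDerived n).obj (ModuleCat.of Bᵐᵒᵖ T)

instance : AddCommGroup (TorMod k A B T W n) :=
  inferInstanceAs (AddCommGroup (((tensorFunctor k B W).leftDerived n).obj (ModuleCat.of Bᵐᵒᵖ T)))

instance : Module k (TorMod k A B T W n) :=
  inferInstanceAs (Module k (((tensorFunctor k B W).leftDerived n).obj (ModuleCat.of Bᵐᵒᵖ T)))

variable {A} in
/-- Left multiplication by `a` on an `A`-`B`-bimodule, an endomorphism of the right
`B`-module `T`. -/
def leftMulHom (a : A) : ModuleCat.of Bᵐᵒᵖ T ⟶ ModuleCat.of Bᵐᵒᵖ T :=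
  haveI : SMulCommClass Bᵐᵒᵖ A T := SMulCommClass.symm _ _ _
  ModuleCat.ofHom (DistribSMul.toLinearMap Bᵐᵒᵖ T a)

variable {A} in
/-- The endomorphism of `Tor_n^B(T, W)` induced by left multiplication by `a` on `T`. -/
def torAction (a : A) : ((tensorFunctor k B W).leftDerived n).obj (ModuleCat.of Bᵐᵒᵖ T) ⟶
    ((tensorFunctor k B W).leftDerived n).obj (ModuleCat.of Bᵐᵒᵖ T) :=
  ((tensorFunctor k B W).leftDerived n).map (leftMulHom B T a)

lemma torAction_one : torAction k B T W n (1 : A) = 𝟙 _ := by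
  have : leftMulHom B T (1 : A) = 𝟙 _ := by
    ext t; exact one_smul A t
  rw [torAction, this, CategoryTheory.Functor.map_id]

lemma torAction_mul (a b : A) :
    torAction k B T W n (a * b) = torAction k B T W n b ≫ torAction k B T W n a := by
  have : leftMulHom B T (a * b) = leftMulHom B T b ≫ leftMulHom B T a := by
    ext t; exact mul_smul a b t
  rw [torAction, this, Functor.map_comp, torAction, torAction]

lemma torAction_add (a b : A) :
    torAction k B T W n (a + b) = torAction k B T W n a + torAction k B T W n b := by
  have : leftMulHom B T (a + b) = leftMulHom B T a + leftMulHom B T b := by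
    ext t; exact add_smul a b t
  rw [torAction, this, Functor.map_add, torAction, torAction]

lemma torAction_zero : torAction k B T W n (0 : A) = 0 := by
  have : leftMulHom B T (0 : A) = 0 := by
    ext t; exact zero_smul A t
  rw [torAction, this, Functor.map_zero]

/-- `A` acts on `Tor_n^B(T, W)` through its left action on `T`, by functoriality. -/
instance : Module A (TorMod k A B T W n) where
  smul a x := (torAction k B T W n a).hom x
  one_smul x := congrArg (fun f => f.hom x) (torAction_one k A B T W n)
  mul_smul a b x := congrArg (fun f => f.hom x) (torAction_mul k A B T W n a b)
  smul_zero a := map_zero (torAction k B T W n a).hom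
  smul_add a x y := map_add (torAction k B T W n a).hom x y
  add_smul a b x := congrArg (fun f => f.hom x) (torAction_add k A B T W n a b)
  zero_smul x := congrArg (fun f => f.hom x) (torAction_zero k A B T W n)

variable [Algebra k A] [Module k T] [IsScalarTower k A T] [IsScalarTower k Bᵐᵒᵖ T]

lemma torAction_smul (c : k) (a : A) :
    torAction k B T W n (c • a) = linearSMul c (torAction k B T W n a) := by
  have : leftMulHom B T (c • a) = linearSMul c (leftMulHom B T a) := by
    ext t
    change (c • a) • t = (algebraMap k Bᵐᵒᵖ c) • (a • t)
    rw [smul_assoc, algebraMap_smul]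
  rw [torAction, this, Functor.map_smul, torAction]

instance : IsScalarTower k A (TorMod k A B T W n) where
  smul_assoc c a x := (congrArg (fun f => f.hom x) (torAction_smul k A B T W n c a)).trans
    (algebraMap_smul k c ((torAction k B T W n a).hom x))

end TorModule

/-! ### Regular families of cohomology and homology classes -/

section Classes

variable {k : Type u} [Field k] [IsAlgClosed k] {Z : Scheme.{u}} {p : Z ⟶ Spec (.of k)}
  [LocallyOfFiniteType p]
  {A B T : Type u} [Ring A] [Ring B] [AddCommGroup T]

/-- Let `P` be a projective resolution of the `A`-module `T`, so that `Ext_A^n(T, V_z)` is the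
`n`-th cohomology of `Hom_A(P, V_z)`. The family `s` of classes in `Ext_A^n(T, V_z)` is represented,
locally on `U`, by cocycles `f_z ∈ Hom_A(P_n, V_z)` depending regularly on `z`, which means that
`z ↦ f_z(x)` is a regular section of `(V_z)` for each `x ∈ P_n`. -/
def IsRegularExtFamily [Module A T] {V : closedPoints Z → Type u} [∀ z, AddCommGroup (V z)]
    [∀ z, Module k (V z)] [∀ z, Module A (V z)] (E : AlgVectorBundle p V)
    (P : ProjectiveResolution (ModuleCat.of A T)) (n : ℕ) (U : Z.Opens)
    (s : ∀ z, ExtMod A B T (V z) n) : Prop :=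
  ∀ z : closedPoints Z, z.1 ∈ U → ∃ W : Z.Opens, W ≤ U ∧ z.1 ∈ W ∧
    ∃ (f : ∀ w, P.complex.X n ⟶ ModuleCat.of A (V w))
      (hf : ∀ w, P.complex.d (n + 1) n ≫ f w = 0),
      (∀ x : P.complex.X n, E.IsRegularSection W (fun w => (f w).hom x)) ∧
      ∀ w : closedPoints Z, w.1 ∈ W → s w = P.extMk (f w) (n + 1) rfl (hf w)

variable [Algebra k B] [Module Bᵐᵒᵖ T]

/-- Let `P` be a projective resolution of the right `B`-module `T`, so that `Tor_n^B(T, W)` is the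
`n`-th homology of `P ⊗_B W`. The element `c ∈ P_n ⊗_B W` is a cycle, and its class is `x`. -/
def RepresentsTor (A : Type u) (P : ProjectiveResolution (ModuleCat.of Bᵐᵒᵖ T)) {W : Type u}
    [AddCommGroup W] [Module k W] [Module B W] (n : ℕ)
    (c : (tensorFunctor k B W).obj (P.complex.X n)) (x : TorMod k A B T W n) : Prop :=
  ∃ y : (((tensorFunctor k B W).mapHomologicalComplex _).obj P.complex).cycles n,
    ((((tensorFunctor k B W).mapHomologicalComplex _).obj P.complex).iCycles n).hom y = c ∧
    (P.isoLeftDerivedObj (tensorFunctor k B W) n).inv.hom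
      (((((tensorFunctor k B W).mapHomologicalComplex _).obj P.complex).homologyπ n).hom y) = x

/-- The family `s` of classes in `Tor_n^B(T, W_z)` is represented, locally on `U`, by cycles
`∑_j x_j ⊗ t_j(z) ∈ P_n ⊗_B W_z`, where the `x_j ∈ P_n` are fixed and the `t_j` are regular
sections of `(W_z)`. -/
def IsRegularTorFamily {W : closedPoints Z → Type u} [∀ z, AddCommGroup (W z)]
    [∀ z, Module k (W z)] [∀ z, Module B (W z)] (E : AlgVectorBundle p W)
    (P : ProjectiveResolution (ModuleCat.of Bᵐᵒᵖ T)) (n : ℕ) (U : Z.Opens)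
    (s : ∀ z, TorMod k A B T (W z) n) : Prop :=
  ∀ z : closedPoints Z, z.1 ∈ U → ∃ U' : Z.Opens, U' ≤ U ∧ z.1 ∈ U' ∧
    ∃ (m : ℕ) (x : Fin m → P.complex.X n) (t : Fin m → ∀ w, W w),
      (∀ j, E.IsRegularSection U' (t j)) ∧
      ∀ w : closedPoints Z, w.1 ∈ U' →
        RepresentsTor A P n (∑ j, balancedTmul k B (W w) (P.complex.X n) (x j) (t j w)) (s w)

end Classes

end

noncomputable section

/-! ### The algebra of regular functions -/

section RegularFunctions

variable {k : Type u} [Field k] [IsAlgClosed k] {Z : Scheme.{u}} (p : Z ⟶ Spec (.of k))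
  [LocallyOfFiniteType p]

/-! Resolve `T` by finitely generated free modules; this is possible because a finite-dimensional
algebra is noetherian. In a local frame of the given family, the terms of `Hom_A(Q, V_z)`, resp. `Q
⊗_B W_z`, are fixed coordinate spaces, and the differentials are matrices whose entries are regular
in `z`, since their blocks are action matrices of fixed elements of the algebra.

The dimension of the homology in degree `l` plus the ranks of the two adjacent differentials is the
dimension of the `l`-th term. Starting from the zero map at the end of the complex, constancy of the
homology dimensions up to degree `n` forces constancy of the ranks of all differentials adjacent to
degrees `≤ n` (`rank_eq_of_recurrence`).

Let `D`, `E` be consecutive regular matrices of constant rank. Locally they have regular generalized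
inverses `G`, `H`, with `DGD = D` and `EHE = E`. Then `(1 - DG)(1 - HE)` is a regular idempotent
that projects onto a complement of `im D` in `ker E`. It has constant rank, so locally the homology
gets a frame of regular cycles and a regular matrix reading off coordinates
(`IsRegularMatrix.exists_homology_frame`). In such a frame, regular coordinates mean being locally
the class of a regular cycle (`exists_frame_of_isHomologyOf`).

This last condition involves no frame, so the local frames automatically glue
(`exists_moduleFamily`). A lift of an endomorphism of `T` to a chain map between resolutions does
not depend on `z` and therefore preserves the condition. The identity gives independence of the
resolution, and multiplications on `T` give regularity of the action. -/

lemma sectionValue_add {U : Z.Opens} (s t : Γ(Z, U)) (z : closedPoints Z) (hz : z.1 ∈ U) :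
    sectionValue p (s + t) z hz = sectionValue p s z hz + sectionValue p t z hz := by
  simp [sectionValue]

lemma sectionValue_mul {U : Z.Opens} (s t : Γ(Z, U)) (z : closedPoints Z) (hz : z.1 ∈ U) :
    sectionValue p (s * t) z hz = sectionValue p s z hz * sectionValue p t z hz := by
  simp [sectionValue]

lemma sectionValue_one {U : Z.Opens} (z : closedPoints Z) (hz : z.1 ∈ U) :
    sectionValue p (1 : Γ(Z, U)) z hz = 1 := by
  simp [sectionValue]

lemma sectionValue_restrict {U W : Z.Opens} (h : W ≤ U) (s : Γ(Z, U)) (z : closedPoints Z)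
    (hz : z.1 ∈ W) :
    sectionValue p (Z.presheaf.map (homOfLE h).op s) z hz = sectionValue p s z (h hz) := by
  simp only [sectionValue, Scheme.evaluation, CommRingCat.comp_apply]
  erw [TopCat.Presheaf.germ_res_apply]

lemma sectionValue_ne_zero_iff {U : Z.Opens} (s : Γ(Z, U)) (z : closedPoints Z) (hz : z.1 ∈ U) :
    sectionValue p s z hz ≠ 0 ↔ z.1 ∈ Z.basicOpen s := by
  rw [← Scheme.evaluation_ne_zero_iff_mem_basicOpen _ _ hz, sectionValue, ne_eq, ne_eq,
    map_eq_zero_iff]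
  exact (residueFieldIsoBase p z.1 z.2).commRingCatIsoToRingEquiv.injective

/-- The composite `Spec κ(z) ⟶ Z ⟶ Spec k` is `Spec` of the inverse of `residueFieldIsoBase`, so
pulling a constant back along `p` and evaluating at `z` is that inverse. -/
lemma sectionValue_const (c : k) (z : closedPoints Z) :
    sectionValue p (U := ⊤) (p.appTop ((Scheme.ΓSpecIso (.of k)).inv c)) z trivial = c := by
  have h : (residueFieldIsoBase p z.1 z.2).inv =
      (Scheme.ΓSpecIso (.of k)).inv ≫ p.appTop ≫ Z.Γevaluation z.1 := by
    have h1 : p.appTop ≫ Z.Γevaluation z.1 = (p.appTop ≫ (Z.fromSpecResidueField z.1).appTop) ≫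
        (Scheme.ΓSpecIso _).hom := by
      have h2 : (Z.fromSpecStalk z.1).appTop =
          Z.presheaf.germ ⊤ z.1 trivial ≫ (Scheme.ΓSpecIso (Z.presheaf.stalk z.1)).inv := by
        rw [Scheme.fromSpecStalk_appTop, show (homOfLE le_top).op =
          𝟙 (Opposite.op (⊤ : (Spec (Z.presheaf.stalk z.1)).Opens)) from Subsingleton.elim _ _]
        erw [CategoryTheory.Functor.map_id]
        rw [Category.comp_id]
      rw [Scheme.fromSpecResidueField, Scheme.Hom.comp_appTop, h2, Category.assoc, Category.assoc,
        Category.assoc, Scheme.ΓSpecIso_naturality, Iso.inv_hom_id_assoc]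
      rfl
    rw [h1, ← Scheme.Hom.comp_appTop, ← SpecMap_residueFieldIsoBase_inv p z.1 z.2]
    simp
  have h2 := congrArg (fun f => f.hom c) h
  change _ = Z.Γevaluation z.1 (p.appTop ((Scheme.ΓSpecIso (.of k)).inv c)) at h2
  change (residueFieldIsoBase p z.1 z.2).hom
    (Z.Γevaluation z.1 (p.appTop ((Scheme.ΓSpecIso (.of k)).inv c))) = c
  rw [← h2]
  exact (residueFieldIsoBase p z.1 z.2).commRingCatIsoToRingEquiv.apply_symm_apply c

lemma IsRegularOn.mono {U W : Z.Opens} (h : W ≤ U) {f : closedPoints Z → k}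
    (hf : IsRegularOn p U f) : IsRegularOn p W f := by
  intro z hz
  obtain ⟨W', hW', hz', s, hs⟩ := hf z (h hz)
  refine ⟨W' ⊓ W, inf_le_right, ⟨hz', hz⟩, Z.presheaf.map (homOfLE inf_le_left).op s, ?_⟩
  intro w hw
  rw [sectionValue_restrict, hs]

lemma IsRegularOn.congr {U : Z.Opens} {f g : closedPoints Z → k}
    (hf : IsRegularOn p U f) (h : ∀ z : closedPoints Z, z.1 ∈ U → f z = g z) :
    IsRegularOn p U g := by
  intro z hz
  obtain ⟨W', hW', hz', s, hs⟩ := hf z hz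
  exact ⟨W', hW', hz', s, fun w hw => (hs w hw).trans (h w (hW' hw))⟩

lemma IsRegularOn.of_local {U : Z.Opens} {f : closedPoints Z → k}
    (hf : ∀ z : closedPoints Z, z.1 ∈ U → ∃ W : Z.Opens, z.1 ∈ W ∧ IsRegularOn p W f) :
    IsRegularOn p U f := by
  intro z hz
  obtain ⟨W, hW, h⟩ := hf z hz
  obtain ⟨W', hW', hz', s, hs⟩ := IsRegularOn.mono p (inf_le_left (b := U)) h z ⟨hW, hz⟩
  exact ⟨W', hW'.trans inf_le_right, hz', s, hs⟩

/-- The algebra of functions which are regular on `U`. -/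
def regularFunctions (U : Z.Opens) : Subalgebra k (closedPoints Z → k) where
  carrier := {f | IsRegularOn p U f}
  add_mem' := by
    intro f g hf hg z hz
    obtain ⟨W, hW, hzW, s, hs⟩ := hf z hz
    obtain ⟨W', hW', hzW', t, ht⟩ := hg z hz
    refine ⟨W ⊓ W', inf_le_left.trans hW, ⟨hzW, hzW'⟩,
      Z.presheaf.map (homOfLE inf_le_left).op s + Z.presheaf.map (homOfLE inf_le_right).op t, ?_⟩
    intro w hw
    rw [sectionValue_add, sectionValue_restrict, sectionValue_restrict, hs, ht, Pi.add_apply]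
  mul_mem' := by
    intro f g hf hg z hz
    obtain ⟨W, hW, hzW, s, hs⟩ := hf z hz
    obtain ⟨W', hW', hzW', t, ht⟩ := hg z hz
    refine ⟨W ⊓ W', inf_le_left.trans hW, ⟨hzW, hzW'⟩,
      Z.presheaf.map (homOfLE inf_le_left).op s * Z.presheaf.map (homOfLE inf_le_right).op t, ?_⟩
    intro w hw
    rw [sectionValue_mul, sectionValue_restrict, sectionValue_restrict, hs, ht, Pi.mul_apply]
  algebraMap_mem' := by
    intro c z hz
    refine ⟨U, le_rfl, hz, Z.presheaf.map (homOfLE le_top).op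
      (p.appTop ((Scheme.ΓSpecIso (.of k)).inv c)), ?_⟩
    intro w hw
    rw [sectionValue_restrict, sectionValue_const]
    rfl

lemma mem_regularFunctions {U : Z.Opens} {f : closedPoints Z → k} :
    f ∈ regularFunctions p U ↔ IsRegularOn p U f := Iff.rfl

lemma regularFunctions_mono {U W : Z.Opens} (h : W ≤ U) :
    regularFunctions p U ≤ regularFunctions p W := fun _ hf => IsRegularOn.mono p h hf

/-- Near `z` the function comes from a section `s`. On `Z.basicOpen s`, the locus where its value is
nonzero, `s` is a unit, and its inverse is a section. -/
lemma exists_inv_mem_regularFunctions {U : Z.Opens} {f : closedPoints Z → k}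
    (hf : f ∈ regularFunctions p U) (z : closedPoints Z) (hz : z.1 ∈ U) (hfz : f z ≠ 0) :
    ∃ W ≤ U, z.1 ∈ W ∧ (∀ w : closedPoints Z, w.1 ∈ W → f w ≠ 0) ∧
      f⁻¹ ∈ regularFunctions p W := by
  obtain ⟨W, hW, hzW, s, hs⟩ := hf z hz
  have hle : Z.basicOpen s ≤ W := Z.basicOpen_le s
  have key : ∀ w : closedPoints Z, w.1 ∈ Z.basicOpen s → f w ≠ 0 := by
    intro w hw
    rw [← hs w (hle hw), sectionValue_ne_zero_iff]
    exact hw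
  refine ⟨Z.basicOpen s, hle.trans hW, ?_, key, ?_⟩
  · rwa [← sectionValue_ne_zero_iff p s z hzW, hs]
  · have hu : IsUnit (Z.presheaf.map (homOfLE hle).op s) :=
      RingedSpace.isUnit_res_basicOpen (X := Z.toLocallyRingedSpace.toRingedSpace) s
    obtain ⟨t, ht⟩ := hu.exists_right_inv
    intro w hw
    refine ⟨Z.basicOpen s, le_rfl, hw, t, fun v hv => ?_⟩
    rw [Pi.inv_apply]
    have h1 : sectionValue p (Z.presheaf.map (homOfLE hle).op s * t) v hv = 1 := by
      refine Eq.trans ?_ (sectionValue_one p v hv)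
      exact congrArg (fun a => sectionValue p a v hv) ht
    rw [sectionValue_mul, sectionValue_restrict, hs] at h1
    exact eq_inv_of_mul_eq_one_right h1

end RegularFunctions

/-! ### Matrices of constant rank -/

section ConstantRank

/-- The columns of `α` are preimages of a basis of `im D`; `β` retracts onto `im D` and takes
coordinates. The product replaces an invertible maximal minor: with `α`, `β` fixed, it stays
invertible when `D` varies slightly. -/
lemma Matrix.exists_mul_mul_eq_one {k : Type*} [Field k] {m n : Type*} [Fintype m] [Fintype n]
    (D : Matrix m n k) :
    ∃ (α : Matrix n (Fin D.rank) k) (β : Matrix (Fin D.rank) m k), β * (D * α) = 1 := by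
  classical
  let b : Module.Basis (Fin D.rank) k (LinearMap.range D.mulVecLin) :=
    Module.finBasisOfFinrankEq k _ rfl
  have hb : ∀ i, ∃ x : n → k, D.mulVecLin x = (b i : m → k) := fun i => (b i).2
  choose x hx using hb
  obtain ⟨g, hg⟩ := (LinearMap.range D.mulVecLin).subtype.exists_leftInverse_of_injective
    (Submodule.ker_subtype _)
  let ψ : (m → k) →ₗ[k] (Fin D.rank → k) := b.equivFun.toLinearMap ∘ₗ g
  refine ⟨Matrix.of fun j i => x i j, LinearMap.toMatrix' ψ, ?_⟩
  have hψ : ∀ i, ψ (D.mulVec (x i)) = Pi.single i 1 := by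
    intro i
    have h1 : g (b i : m → k) = b i := LinearMap.congr_fun hg (b i)
    have h2 : D.mulVec (x i) = (b i : m → k) := hx i
    rw [h2]
    change b.equivFun (g (b i)) = _
    rw [h1]
    ext j
    simp [Module.Basis.equivFun_self, Pi.single_apply, eq_comm]
  ext i j
  have h3 : (LinearMap.toMatrix' ψ * (D * Matrix.of fun j i => x i j)) i j =
      (LinearMap.toMatrix' ψ).mulVec (D.mulVec (x j)) i := by
    simp only [Matrix.mul_apply, Matrix.mulVec, dotProduct, Matrix.of_apply]
  rw [h3, LinearMap.toMatrix'_mulVec, hψ, Matrix.one_apply, Pi.single_apply]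

/-- Invertibility gives `r ≤ rank (D * α)`, while `im (D * α) ⊆ im D` and `rank D ≤ r`; hence the
two images agree. -/
lemma Matrix.exists_mul_eq_of_isUnit_det {k : Type*} [Field k] {m n : Type*} [Fintype m]
    [Fintype n] {r : ℕ} {D : Matrix m n k} {α : Matrix n (Fin r) k} {β : Matrix (Fin r) m k}
    (hr : D.rank ≤ r) (h : IsUnit (β * (D * α)).det) (x : n → k) :
    ∃ y, D.mulVec x = (D * α).mulVec y := by
  classical
  have h1 : LinearMap.range (D * α).mulVecLin ≤ LinearMap.range D.mulVecLin := by
    rw [Matrix.mulVecLin_mul]; exact LinearMap.range_comp_le_range _ _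
  have h2 : r ≤ (D * α).rank := by
    have := Matrix.rank_of_isUnit _ ((Matrix.isUnit_iff_isUnit_det _).2 h)
    rw [Fintype.card_fin] at this
    exact this.ge.trans (Matrix.rank_mul_le_right _ _)
  have h3 : LinearMap.range (D * α).mulVecLin = LinearMap.range D.mulVecLin :=
    Submodule.eq_of_le_of_finrank_le h1 (hr.trans h2)
  have h4 : D.mulVecLin x ∈ LinearMap.range (D * α).mulVecLin := h3 ▸ LinearMap.mem_range_self _ x
  obtain ⟨y, hy⟩ := h4
  exact ⟨y, hy.symm⟩

/-- The identity holds after multiplying by `α` on the right, by cancellation, and the columns of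
`D` lie in the image of `D * α`. -/
lemma Matrix.mul_nonsing_inv_mul_mul {k : Type*} [Field k] {m n : Type*} [Fintype m]
    [Fintype n] {r : ℕ} {D : Matrix m n k} {α : Matrix n (Fin r) k} {β : Matrix (Fin r) m k}
    (hr : D.rank ≤ r) (h : IsUnit (β * (D * α)).det) :
    D * (α * (β * (D * α))⁻¹ * β) * D = D := by
  classical
  have key : D * (α * (β * (D * α))⁻¹ * β) * (D * α) = D * α := by
    calc D * (α * (β * (D * α))⁻¹ * β) * (D * α)
        = (D * α) * ((β * (D * α))⁻¹ * (β * (D * α))) := by simp only [Matrix.mul_assoc]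
      _ = D * α := by rw [Matrix.nonsing_inv_mul _ h, Matrix.mul_one]
  apply Matrix.ext_of_mulVec_single
  intro i
  obtain ⟨y, hy⟩ := Matrix.exists_mul_eq_of_isUnit_det hr h (Pi.single i 1)
  rw [← Matrix.mulVec_mulVec, hy, Matrix.mulVec_mulVec, key]

/-- The matrix `Q` restricted to `ker E` has kernel `im D` and the same image as `Q`, so `rank Q =
dim ker E - rank D`. This makes the rank of the projection onto homology constant once those of `D`
and `E` are. -/
lemma Matrix.rank_add_rank_add_rank {k : Type*} [Field k] {a b c : Type*} [Fintype a]
    [Fintype b] [Fintype c] {D : Matrix b a k} {E : Matrix c b k} {Q : Matrix b b k}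
    (hED : E * D = 0) (hQD : Q * D = 0)
    (hQ : ∀ x, E.mulVec x = 0 → Q.mulVec x = 0 → ∃ y, D.mulVec y = x)
    (hQE : ∀ x, ∃ y, E.mulVec y = 0 ∧ Q.mulVec y = Q.mulVec x) :
    Q.rank + D.rank + E.rank = Fintype.card b := by
  let K := LinearMap.ker E.mulVecLin
  have h1 : E.rank + Module.finrank k K = Fintype.card b := by
    rw [← Module.finrank_fintype_fun_eq_card k]
    exact LinearMap.finrank_range_add_finrank_ker E.mulVecLin
  let q := Q.mulVecLin.domRestrict K
  have h2 : LinearMap.range q = LinearMap.range Q.mulVecLin := by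
    ext y
    constructor
    · rintro ⟨x, rfl⟩
      exact ⟨x.1, rfl⟩
    · rintro ⟨x, rfl⟩
      obtain ⟨y, hy, h⟩ := hQE x
      exact ⟨⟨y, hy⟩, h⟩
  have h3 : (LinearMap.ker q).map K.subtype = LinearMap.range D.mulVecLin := by
    ext y
    constructor
    · rintro ⟨x, hx, rfl⟩
      obtain ⟨y, hy⟩ := hQ x.1 x.2 hx
      exact ⟨y, hy⟩
    · rintro ⟨x, rfl⟩
      refine ⟨⟨D.mulVec x, ?_⟩, ?_, rfl⟩
      · change E.mulVec (D.mulVec x) = 0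
        rw [Matrix.mulVec_mulVec, hED, Matrix.zero_mulVec]
      · change Q.mulVec (D.mulVec x) = 0
        rw [Matrix.mulVec_mulVec, hQD, Matrix.zero_mulVec]
  have h4 : Q.rank + D.rank = Module.finrank k K := by
    rw [← LinearMap.finrank_range_add_finrank_ker q, Matrix.rank, Matrix.rank, h2, ← h3]
    congr 1
    exact (LinearEquiv.finrank_eq (Submodule.equivMapOfInjective _ K.injective_subtype _)).symm
  omega

variable {k : Type u} [Field k] [IsAlgClosed k] {Z : Scheme.{u}} (p : Z ⟶ Spec (.of k))
  [LocallyOfFiniteType p]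

/-- All entries of the matrix-valued function `D` are regular on `U`. -/
def IsRegularMatrix {m n : Type*} (U : Z.Opens) (D : closedPoints Z → Matrix m n k) : Prop :=
  ∀ i j, (fun z => D z i j) ∈ regularFunctions p U

namespace IsRegularMatrix

variable {p} {m n l : Type*} {U : Z.Opens}

lemma mono {W : Z.Opens} {D : closedPoints Z → Matrix m n k} (hD : IsRegularMatrix p U D)
    (h : W ≤ U) : IsRegularMatrix p W D := fun i j => regularFunctions_mono p h (hD i j)

lemma const (D : Matrix m n k) : IsRegularMatrix p U (fun _ => D) :=
  fun i j => (regularFunctions p U).algebraMap_mem (D i j)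

lemma mul [Fintype n] {D : closedPoints Z → Matrix m n k} {E : closedPoints Z → Matrix n l k}
    (hD : IsRegularMatrix p U D) (hE : IsRegularMatrix p U E) :
    IsRegularMatrix p U (fun z => D z * E z) := by
  intro i j
  have : (fun z => (D z * E z) i j) = ∑ x, (fun z => D z i x) * (fun z => E z x j) := by
    ext z; simp [Matrix.mul_apply]
  rw [this]
  exact sum_mem fun x _ => mul_mem (hD i x) (hE x j)

lemma sub {D E : closedPoints Z → Matrix m n k}
    (hD : IsRegularMatrix p U D) (hE : IsRegularMatrix p U E) :
    IsRegularMatrix p U (fun z => D z - E z) := fun i j => sub_mem (hD i j) (hE i j)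

lemma det [Fintype n] [DecidableEq n] {D : closedPoints Z → Matrix n n k}
    (hD : IsRegularMatrix p U D) : (fun z => (D z).det) ∈ regularFunctions p U := by
  have : (fun z => (D z).det) =
      ∑ σ : Equiv.Perm n, (Equiv.Perm.sign σ : ℤ) • ∏ i, (fun z => D z (σ i) i) := by
    ext z; simp [Matrix.det_apply, Units.smul_def]
  rw [this]
  exact sum_mem fun σ _ => zsmul_mem (prod_mem fun i _ => hD _ _) _

lemma adjugate [Fintype n] [DecidableEq n] {D : closedPoints Z → Matrix n n k}
    (hD : IsRegularMatrix p U D) : IsRegularMatrix p U (fun z => (D z).adjugate) := by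
  intro i j
  simp only [Matrix.adjugate_apply]
  refine det fun a b => ?_
  by_cases h : a = j
  · subst h
    simp only [Matrix.updateRow_self]
    exact (regularFunctions p U).algebraMap_mem ((Pi.single i 1 : n → k) b)
  · simp only [Matrix.updateRow_ne h]
    exact hD a b

/-- A regular matrix which is invertible at a point has a regular inverse near it. -/
lemma exists_inv [Fintype n] [DecidableEq n] {D : closedPoints Z → Matrix n n k}
    (hD : IsRegularMatrix p U D) (z : closedPoints Z) (hz : z.1 ∈ U) (h : IsUnit (D z).det) :
    ∃ W ≤ U, z.1 ∈ W ∧ (∀ w : closedPoints Z, w.1 ∈ W → IsUnit (D w).det) ∧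
      IsRegularMatrix p W (fun w => (D w)⁻¹) := by
  obtain ⟨W, hW, hzW, h1, h2⟩ := exists_inv_mem_regularFunctions p hD.det z hz h.ne_zero
  refine ⟨W, hW, hzW, fun w hw => (h1 w hw).isUnit, fun i j => ?_⟩
  have : (fun z => (D z)⁻¹ i j) = (fun z => (D z).det)⁻¹ * (fun z => (D z).adjugate i j) := by
    ext z; simp [Matrix.inv_def]
  rw [this]
  exact mul_mem h2 (hD.adjugate.mono hW i j)

lemma mulVec [Fintype n] {D : closedPoints Z → Matrix m n k} {v : closedPoints Z → n → k}
    (hD : IsRegularMatrix p U D) (hv : ∀ i, (fun z => v z i) ∈ regularFunctions p U) (i : m) :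
    (fun z => (D z).mulVec (v z) i) ∈ regularFunctions p U := by
  have : (fun z => (D z).mulVec (v z) i) = ∑ x, (fun z => D z i x) * (fun z => v z x) := by
    ext z; simp [Matrix.mulVec, dotProduct]
  rw [this]
  exact sum_mem fun x _ => mul_mem (hD i x) (hv x)

/-- A regular matrix whose rank does not jump up near `z` has a compression which is invertible
near `z`. -/
lemma exists_minor [Fintype m] [Fintype n] {D : closedPoints Z → Matrix m n k}
    (hD : IsRegularMatrix p U D) (z : closedPoints Z) (hz : z.1 ∈ U) :
    ∃ W ≤ U, z.1 ∈ W ∧ ∃ (α : Matrix n (Fin (D z).rank) k) (β : Matrix (Fin (D z).rank) m k),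
      (∀ w : closedPoints Z, w.1 ∈ W → IsUnit (β * (D w * α)).det) ∧
      IsRegularMatrix p W (fun w => (β * (D w * α))⁻¹) := by
  obtain ⟨α, β, h⟩ := (D z).exists_mul_mul_eq_one
  -- The matrices `α`, `β` are chosen at `z` and kept constant, so `β * (D w * α)` is regular in `w`
  -- and equals `1` at `z`.
  obtain ⟨W, hW, hzW, h1, h2⟩ := exists_inv ((const (p := p) (U := U) β).mul (hD.mul (const α)))
    z hz (by rw [h]; simp)
  exact ⟨W, hW, hzW, α, β, h1, h2⟩

/-- A regular matrix of constant rank has locally a regular generalized inverse. -/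
lemma exists_mul_mul_eq [Fintype m] [Fintype n] {D : closedPoints Z → Matrix m n k}
    (hD : IsRegularMatrix p U D) (hr : ∀ z w : closedPoints Z, z.1 ∈ U → w.1 ∈ U →
      (D z).rank = (D w).rank) (z : closedPoints Z) (hz : z.1 ∈ U) :
    ∃ W ≤ U, z.1 ∈ W ∧ ∃ G : closedPoints Z → Matrix n m k, IsRegularMatrix p W G ∧
      ∀ w : closedPoints Z, w.1 ∈ W → D w * G w * D w = D w := by
  obtain ⟨W, hW, hzW, α, β, h1, h2⟩ := hD.exists_minor z hz
  exact ⟨W, hW, hzW, fun w => α * (β * (D w * α))⁻¹ * β, ((const α).mul h2).mul (const β),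
    fun w hw => Matrix.mul_nonsing_inv_mul_mul (hr w z (hW hw) hz).le (h1 w hw)⟩

/-- The homology of a complex of regular matrices of constant rank has local frames: the columns of
`v` are cycles whose classes form a basis, and `L` computes the coordinates of a class. -/
lemma exists_homology_frame {a b c : Type*} [Fintype a] [Fintype b] [Fintype c]
    {D : closedPoints Z → Matrix b a k} {E : closedPoints Z → Matrix c b k}
    (hD : IsRegularMatrix p U D) (hE : IsRegularMatrix p U E)
    (hED : ∀ w : closedPoints Z, w.1 ∈ U → E w * D w = 0)
    (hDr : ∀ z w : closedPoints Z, z.1 ∈ U → w.1 ∈ U → (D z).rank = (D w).rank)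
    (hEr : ∀ z w : closedPoints Z, z.1 ∈ U → w.1 ∈ U → (E z).rank = (E w).rank)
    (z : closedPoints Z) (hz : z.1 ∈ U) :
    ∃ W ≤ U, z.1 ∈ W ∧ ∃ (r : ℕ) (v : closedPoints Z → Matrix b (Fin r) k)
      (L : closedPoints Z → Matrix (Fin r) b k), IsRegularMatrix p W v ∧ IsRegularMatrix p W L ∧
      ∀ w : closedPoints Z, w.1 ∈ W → E w * v w = 0 ∧ L w * v w = 1 ∧ L w * D w = 0 ∧
        ∀ x, (E w).mulVec x = 0 → ∃ y, x = (v w).mulVec ((L w).mulVec x) + (D w).mulVec y := by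
  classical
  obtain ⟨W₁, hW₁, hz₁, G, hG, hDG⟩ := hD.exists_mul_mul_eq hDr z hz
  obtain ⟨W₂, hW₂, hz₂, H, hH, hEH⟩ := hE.exists_mul_mul_eq hEr z hz
  -- The steps below show `Q D = 0`, `E Q = 0`, `Q² = Q`, and that `Q` is the identity modulo `im D`
  -- on `ker E`: it projects onto a complement of `im D` in `ker E`.
  let Q : closedPoints Z → Matrix b b k := fun w => (1 - D w * G w) * (1 - H w * E w)
  have hQ : IsRegularMatrix p (W₁ ⊓ W₂) Q := by
    refine mul ((const 1).sub ?_) ((const 1).sub ?_)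
    · exact (hD.mono (inf_le_left.trans hW₁)).mul (hG.mono inf_le_left)
    · exact (hH.mono inf_le_right).mul (hE.mono (inf_le_right.trans hW₂))
  have hQe : ∀ w, Q w = (1 - D w * G w) * (1 - H w * E w) := fun _ => rfl
  clear_value Q
  have hQD : ∀ w : closedPoints Z, w.1 ∈ W₁ ⊓ W₂ → Q w * D w = 0 := by
    intro w hw
    calc Q w * D w = (1 - D w * G w) * (D w - H w * (E w * D w)) := by
          simp only [hQe, Matrix.mul_assoc, Matrix.sub_mul, Matrix.one_mul]
      _ = D w - D w * G w * D w := by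
          rw [hED w (hW₁ hw.1), Matrix.mul_zero, sub_zero, Matrix.sub_mul, Matrix.one_mul]
      _ = 0 := by rw [hDG w hw.1, sub_self]
  have hEQ : ∀ w : closedPoints Z, w.1 ∈ W₁ ⊓ W₂ → E w * Q w = 0 := by
    intro w hw
    calc E w * Q w = (E w - E w * D w * G w) * (1 - H w * E w) := by
          simp only [hQe, ← Matrix.mul_assoc, Matrix.mul_sub, Matrix.mul_one]
      _ = E w - E w * H w * E w := by
          rw [hED w (hW₁ hw.1), Matrix.zero_mul, sub_zero, Matrix.mul_sub, Matrix.mul_one,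
            Matrix.mul_assoc]
      _ = 0 := by rw [hEH w hw.2, sub_self]
  have hQx : ∀ w : closedPoints Z, w.1 ∈ W₁ ⊓ W₂ → ∀ x, (E w).mulVec x = 0 →
      (Q w).mulVec x = x - (D w).mulVec ((G w).mulVec x) := by
    intro w hw x hx
    rw [hQe, ← Matrix.mulVec_mulVec, Matrix.sub_mulVec 1 (H w * E w), ← Matrix.mulVec_mulVec, hx,
      Matrix.mulVec_zero, sub_zero, Matrix.one_mulVec, Matrix.sub_mulVec, Matrix.one_mulVec,
      Matrix.mulVec_mulVec]
  have hQQ : ∀ w : closedPoints Z, w.1 ∈ W₁ ⊓ W₂ → Q w * Q w = Q w := by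
    intro w hw
    have h : (1 - D w * G w) * D w = 0 := by
      rw [Matrix.sub_mul, Matrix.one_mul, hDG w hw.1, sub_self]
    calc Q w * Q w = (1 - D w * G w) * (Q w - H w * (E w * Q w)) := by
          nth_rewrite 1 [hQe w]
          rw [Matrix.mul_assoc, Matrix.sub_mul 1 (H w * E w), Matrix.one_mul, Matrix.mul_assoc]
      _ = (1 - D w * G w) * (1 - D w * G w) * (1 - H w * E w) := by
          rw [hEQ w hw, Matrix.mul_zero, sub_zero, hQe, Matrix.mul_assoc]
      _ = Q w := by
          rw [hQe, Matrix.mul_sub (1 - D w * G w) 1, Matrix.mul_one, ← Matrix.mul_assoc, h,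
            Matrix.zero_mul, sub_zero]
  have hQr : ∀ w : closedPoints Z, w.1 ∈ W₁ ⊓ W₂ →
      (Q w).rank + (D w).rank + (E w).rank = Fintype.card b := by
    intro w hw
    refine Matrix.rank_add_rank_add_rank (hED w (hW₁ hw.1)) (hQD w hw) (fun x hx hQx' => ?_)
      (fun x => ⟨(Q w).mulVec x, ?_, ?_⟩)
    · rw [hQx w hw x hx, sub_eq_zero] at hQx'
      exact ⟨_, hQx'.symm⟩
    · rw [Matrix.mulVec_mulVec, hEQ w hw, Matrix.zero_mulVec]
    · rw [Matrix.mulVec_mulVec, hQQ w hw]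
  obtain ⟨W, hW, hzW, α, β, h1, h2⟩ := hQ.exists_minor z ⟨hz₁, hz₂⟩
  -- The frame consists of the columns of `Q α`, and its left inverse is `(β Q α)⁻¹ β Q`. The size
  -- is the rank of `Q` at `z`.
  refine ⟨W, hW.trans (inf_le_left.trans hW₁), hzW, _, fun w => Q w * α,
    fun w => (β * (Q w * α))⁻¹ * β * Q w, (hQ.mono hW).mul (const α),
    (h2.mul (const β)).mul (hQ.mono hW), fun w hw => ⟨?_, ?_, ?_, fun x hx => ?_⟩⟩
  · rw [← Matrix.mul_assoc, hEQ w (hW hw), Matrix.zero_mul]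
  · rw [Matrix.mul_assoc, ← Matrix.mul_assoc (Q w), hQQ w (hW hw), Matrix.mul_assoc,
      Matrix.nonsing_inv_mul _ (h1 w hw)]
  · rw [Matrix.mul_assoc, hQD w (hW hw), Matrix.mul_zero]
  -- The rank of `Q` does not jump up, hence the columns of `Q α` span all of `im Q` and not just a
  -- part of it.
  · have hr : (Q w).rank ≤ (Q z).rank := by
      have e1 := hQr w (hW hw)
      have e2 := hQr z ⟨hz₁, hz₂⟩
      have e3 := hDr z w hz (hW₁ (hW hw).1)
      have e4 := hEr z w hz (hW₁ (hW hw).1)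
      omega
    have h3 : (Q w).mulVec x = (Q w * α).mulVec
        (((β * (Q w * α))⁻¹ * β * Q w).mulVec x) := by
      obtain ⟨y, hy⟩ := Matrix.exists_mul_eq_of_isUnit_det hr (h1 w hw) x
      rw [← Matrix.mulVec_mulVec x (_ * β) (Q w), hy, Matrix.mulVec_mulVec y, Matrix.mul_assoc _ β,
        Matrix.nonsing_inv_mul _ (h1 w hw), Matrix.one_mulVec]
    exact ⟨(G w).mulVec x, by rw [← h3, hQx w (hW hw) x hx, sub_add_cancel]⟩

end IsRegularMatrix

end ConstantRank

/-! ### Resolutions by finitely generated free modules -/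

section FreeResolution

namespace FiniteFreeResolution

variable {R : Type u} [Ring R]

/-- The rank of a free module covering the finitely generated module `M`. -/
def coverRank (M : FGModuleCat.{u} R) : ℕ := (Module.Finite.exists_fin' R M).choose

/-- A finitely generated free module covering the finitely generated module `M`. -/
def coverMap (M : FGModuleCat.{u} R) : (Fin (coverRank M) → R) →ₗ[R] M :=
  (Module.Finite.exists_fin' R M).choose_spec.choose

lemma coverMap_surjective (M : FGModuleCat.{u} R) : Function.Surjective (coverMap M) :=
  (Module.Finite.exists_fin' R M).choose_spec.choose_spec

variable [IsNoetherianRing R]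

/-- The iterated syzygies of `M`. -/
def syzygy (M : FGModuleCat.{u} R) : ℕ → FGModuleCat.{u} R
  | 0 => M
  | n + 1 => FGModuleCat.of R (LinearMap.ker (coverMap (syzygy M n)))

/-- The terms of the free resolution of `M`. -/
abbrev term (M : FGModuleCat.{u} R) (n : ℕ) : ModuleCat.{u} R :=
  ModuleCat.of R (Fin (coverRank (syzygy M n)) → R)

/-- The differentials of the free resolution of `M`. -/
def differential (M : FGModuleCat.{u} R) (n : ℕ) : term M (n + 1) ⟶ term M n :=
  ModuleCat.ofHom ((LinearMap.ker (coverMap (syzygy M n))).subtype ∘ₗ coverMap (syzygy M (n + 1)))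

lemma coverMap_differential (M : FGModuleCat.{u} R) (n : ℕ) (x : term M (n + 1)) :
    coverMap (syzygy M n) ((differential M n).hom x) = 0 :=
  (coverMap (syzygy M (n + 1)) x : LinearMap.ker (coverMap (syzygy M n))).2

/-- The differential is the cover of the next syzygy followed by its inclusion; the cover is onto,
so the image is the full kernel of `coverMap`. Since the inclusion is injective, the kernel of the
differential is that of the next cover. Together these give exactness. -/
lemma exists_differential_eq (M : FGModuleCat.{u} R) (n : ℕ) (x : term M n)
    (hx : coverMap (syzygy M n) x = 0) : ∃ y, (differential M n).hom y = x := by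
  obtain ⟨y, hy⟩ := coverMap_surjective (syzygy M (n + 1))
    (⟨x, hx⟩ : LinearMap.ker (coverMap (syzygy M n)))
  exact ⟨y, congrArg Subtype.val hy⟩

lemma coverMap_eq_zero_of_differential (M : FGModuleCat.{u} R) (n : ℕ) (x : term M (n + 1))
    (hx : (differential M n).hom x = 0) : coverMap (syzygy M (n + 1)) x = 0 :=
  Subtype.ext hx

lemma differential_comp (M : FGModuleCat.{u} R) (n : ℕ) :
    differential M (n + 1) ≫ differential M n = 0 := by
  ext1
  refine LinearMap.ext fun x => ?_
  exact congrArg Subtype.val (coverMap_differential M (n + 1) x)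

/-- The underlying complex of the free resolution of `M`. -/
def freeComplex (M : FGModuleCat.{u} R) : ChainComplex (ModuleCat.{u} R) ℕ :=
  ChainComplex.of (term M) (differential M) (differential_comp M)

lemma freeComplex_d (M : FGModuleCat.{u} R) (n : ℕ) :
    (freeComplex M).d (n + 1) n = differential M n :=
  ChainComplex.of_d _ _ _

/-- The augmentation of the free resolution of `M`. -/
def augmentation (M : FGModuleCat.{u} R) : (freeComplex M).X 0 ⟶ M.obj :=
  ModuleCat.ofHom (coverMap M)

lemma d_comp_augmentation (M : FGModuleCat.{u} R) :
    (freeComplex M).d 1 0 ≫ augmentation M = 0 := by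
  rw [freeComplex_d]
  ext1
  exact LinearMap.ext fun x => coverMap_differential M 0 x

/-- The resolution of a finitely generated module over a noetherian ring by finitely generated
free modules. -/
def resolution (M : FGModuleCat.{u} R) : ProjectiveResolution M.obj where
  complex := freeComplex M
  projective n := by
    change Projective (term M n)
    infer_instance
  π := (ChainComplex.toSingle₀Equiv _ _).symm ⟨augmentation M, d_comp_augmentation M⟩
  quasiIso := ⟨fun n => by
    cases n with
    | zero =>
      -- In degree `0` the claim is exactness at the first term together with surjectivity of the
      -- augmentation; in positive degrees the target is acyclic and only exactness is left.
      rw [ChainComplex.quasiIsoAt₀_iff, ShortComplex.quasiIso_iff_of_zeros']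
      · constructor
        · rw [ShortComplex.moduleCat_exact_iff]
          intro x hx
          obtain ⟨y, hy⟩ := exists_differential_eq M 0 x hx
          refine ⟨y, ?_⟩
          rw [← hy, ← freeComplex_d]
          rfl
        · rw [ModuleCat.epi_iff_surjective]
          exact coverMap_surjective M
      all_goals rfl
    | succ n =>
      rw [quasiIsoAt_iff_exactAt']
      · rw [HomologicalComplex.exactAt_iff' _ (n + 1 + 1) (n + 1) n (by simp) (by simp),
          ShortComplex.moduleCat_exact_iff]
        intro x hx
        replace hx : ((freeComplex M).d (n + 1) n).hom x = 0 := hx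
        rw [freeComplex_d] at hx
        obtain ⟨y, hy⟩ := exists_differential_eq M (n + 1) x
          (coverMap_eq_zero_of_differential M n x hx)
        refine ⟨y, ?_⟩
        rw [← hy, ← freeComplex_d]
        rfl
      · apply ChainComplex.exactAt_succ_single_obj⟩

/-- The terms of the resolution are free. -/
def resolutionBasis (M : FGModuleCat.{u} R) (n : ℕ) :
    Module.Basis (Fin (coverRank (syzygy M n))) R ((resolution M).complex.X n) :=
  Pi.basisFun R _

end FiniteFreeResolution

end FreeResolution

/-! ### Families of modules from sheaves of regular sections -/

section RegularSections

variable {k : Type u} [Field k] [IsAlgClosed k] {Z : Scheme.{u}} {p : Z ⟶ Spec (.of k)}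
  [LocallyOfFiniteType p]

/-- A local class `R` of sections of a collection of modules, which near each point consists of the
sections with regular coordinates in some frame and is stable under the action of the algebra,
is the class of regular sections of a family of modules. -/
theorem exists_moduleFamily {A : Type u} [Ring A] [Algebra k A] {H : closedPoints Z → Type u}
    [∀ z, AddCommGroup (H z)] [∀ z, Module k (H z)] [∀ z, Module A (H z)]
    [∀ z, IsScalarTower k A (H z)] (R : Z.Opens → (∀ z, H z) → Prop)
    (mono : ∀ U W s, W ≤ U → R U s → R W s)
    (loc : ∀ (U : Z.Opens) s,
      (∀ z : closedPoints Z, z.1 ∈ U → ∃ W ≤ U, z.1 ∈ W ∧ R W s) → R U s)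
    (m : ℕ)
    (frames : ∀ z : closedPoints Z, ∃ W : Z.Opens, z.1 ∈ W ∧
      ∃ e : ∀ w, Module.Basis (Fin m) k (H w), ∀ U ≤ W, ∀ s,
        R U s ↔ ∀ j, IsRegularOn p U (fun w => (e w).repr (s w) j))
    (act : ∀ (a : A) U s, R U s → R U (fun z => a • s z)) :
    ∃ F : ModuleFamily p A H, ∀ U s, F.IsRegularSection U s ↔ R U s := by
  choose W hW e he using frames
  -- Frame vectors have constant coordinates in their own frame, so they belong to `R`. Transition
  -- and action matrices are then coordinates of members of `R`.
  have hbasis : ∀ i a, R (W i) (fun z => e i z a) := by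
    intro i a
    rw [he i _ le_rfl]
    intro j
    simp only [Module.Basis.repr_self]
    exact (regularFunctions p (W i)).algebraMap_mem (Finsupp.single a (1 : k) j)
  let F : ModuleFamily p A H :=
    { rank := m
      index := closedPoints Z
      chart := W
      covers := fun z => ⟨z, hW z⟩
      frame := e
      transition := fun i j a b =>
        (he j _ inf_le_right _).1 (mono _ _ _ inf_le_left (hbasis i a)) b
      action := fun a i b c => (he i _ le_rfl _).1 (act a _ _ (hbasis i b)) c }
  refine ⟨F, fun U s => ?_⟩
  have h : F.IsRegularSection U s ↔ ∀ i, R (U ⊓ W i) s :=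
    forall_congr' fun i => (he i _ inf_le_right s).symm
  rw [h]
  exact ⟨fun h => loc U s fun z hz => ⟨U ⊓ W z, inf_le_left, ⟨hz, hW z⟩, h z⟩,
    fun h i => mono _ _ _ inf_le_left h⟩

/-- Inside one chart a single frame suffices: the coordinates in any other frame arise by
multiplying with the regular transition matrix. -/
lemma AlgVectorBundle.isRegularSection_iff_of_le {V : closedPoints Z → Type u}
    [∀ z, AddCommGroup (V z)] [∀ z, Module k (V z)] (E : AlgVectorBundle p V) {U : Z.Opens}
    {i : E.index} (hU : U ≤ E.chart i) (s : ∀ z, V z) :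
    E.IsRegularSection U s ↔ ∀ a, IsRegularOn p U (fun z => (E.frame i z).repr (s z) a) := by
  refine ⟨fun h a => (h i a).mono p (le_inf le_rfl hU), fun h j b => ?_⟩
  have h1 : (fun z => (E.frame j z).repr (s z) b) = ∑ a,
      (fun z => (E.frame i z).repr (s z) a) * (fun z => (E.frame j z).repr (E.frame i z a) b) := by
    ext z
    have h2 := congrArg (fun v => (E.frame j z).repr v b) ((E.frame i z).sum_repr (s z))
    simp only [map_sum, map_smul, Finsupp.coe_finsetSum, Finset.sum_apply, Finsupp.smul_apply,
      smul_eq_mul] at h2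
    simp [← h2]
  rw [h1, ← mem_regularFunctions]
  exact sum_mem fun a _ =>
    mul_mem ((h a).mono p inf_le_left) ((E.transition i j a b).mono p (inf_le_inf_right _ hU))

lemma ModuleFamily.isRegularOn_smul {A : Type u} [Ring A] [Algebra k A]
    {V : closedPoints Z → Type u} [∀ z, AddCommGroup (V z)] [∀ z, Module k (V z)]
    [∀ z, Module A (V z)] [∀ z, IsScalarTower k A (V z)] (E : ModuleFamily p A V) {U : Z.Opens}
    {i : E.index} (hU : U ≤ E.chart i) (a : A) (s : ∀ z, V z)
    (hs : ∀ b, IsRegularOn p U (fun z => (E.frame i z).repr (s z) b)) (c : Fin E.rank) :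
    IsRegularOn p U (fun z => (E.frame i z).repr (a • s z) c) := by
  have h1 : (fun z => (E.frame i z).repr (a • s z) c) = ∑ b,
      (fun z => (E.frame i z).repr (s z) b) *
        (fun z => (E.frame i z).repr (a • E.frame i z b) c) := by
    ext z
    have h2 := congrArg (fun v => (E.frame i z).repr (a • v) c) ((E.frame i z).sum_repr (s z))
    simp only [Finset.smul_sum, smul_comm a, map_sum, map_smul, Finsupp.coe_finsetSum,
      Finset.sum_apply, Finsupp.smul_apply, smul_eq_mul] at h2
    simp [← h2]
  rw [h1, ← mem_regularFunctions]
  exact sum_mem fun b _ =>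
    mul_mem (hs b) ((E.action a i b c).mono p hU)

end RegularSections

/-! ### The homology of a family of complexes -/

section Homology

/-- `cl` identifies `H` with the homology of `X → Y → X'`. -/
structure IsHomologyOf {k X Y X' H : Type*} [Field k] [AddCommGroup X] [Module k X]
    [AddCommGroup Y] [Module k Y] [AddCommGroup X'] [Module k X'] [AddCommGroup H] [Module k H]
    (D : X →ₗ[k] Y) (E : Y →ₗ[k] X') (cl : LinearMap.ker E →ₗ[k] H) : Prop where
  apply_apply : ∀ x, E (D x) = 0
  surjective : Function.Surjective cl
  eq_zero_iff : ∀ y, cl y = 0 ↔ ∃ x, D x = y.1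

/-- Rank-nullity for `cl`, whose kernel is `im D`, and for `E`. -/
lemma IsHomologyOf.finrank_add_rank_add_rank {k X Y X' H : Type*} [Field k] [AddCommGroup X]
    [Module k X] [AddCommGroup Y] [Module k Y] [AddCommGroup X'] [Module k X'] [AddCommGroup H]
    [Module k H] [Module.Finite k Y] {D : X →ₗ[k] Y} {E : Y →ₗ[k] X'}
    {cl : LinearMap.ker E →ₗ[k] H} (h : IsHomologyOf D E cl) :
    Module.finrank k H + Module.finrank k (LinearMap.range D) +
      Module.finrank k (LinearMap.range E) = Module.finrank k Y := by
  have h1 := LinearMap.finrank_range_add_finrank_ker cl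
  rw [LinearMap.range_eq_top.2 h.surjective, finrank_top] at h1
  have h2 : (LinearMap.ker cl).map (LinearMap.ker E).subtype = LinearMap.range D := by
    ext y
    constructor
    · rintro ⟨x, hx, rfl⟩
      exact (h.eq_zero_iff x).1 hx
    · rintro ⟨x, rfl⟩
      exact ⟨⟨D x, h.apply_apply x⟩, (h.eq_zero_iff _).2 ⟨x, rfl⟩, rfl⟩
  have h3 := LinearEquiv.finrank_eq (Submodule.equivMapOfInjective _
    (LinearMap.ker E).injective_subtype (LinearMap.ker cl))
  rw [h2] at h3
  have h4 := LinearMap.finrank_range_add_finrank_ker E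
  omega

lemma LinearMap.rank_toMatrix_eq_finrank_range {k X Y a b : Type*} [Field k] [AddCommGroup X]
    [Module k X] [AddCommGroup Y] [Module k Y] [Fintype a] [Fintype b] [DecidableEq a]
    (bX : Module.Basis a k X) (bY : Module.Basis b k Y) (D : X →ₗ[k] Y) :
    (LinearMap.toMatrix bX bY D).rank = Module.finrank k (LinearMap.range D) := by
  rw [Matrix.rank_eq_finrank_range_toLin _ bY bX, Matrix.toLin_toMatrix]

/-- The basis comes from the map `φ` sending `x` to the class of the cycle with coordinates `v x`.
It is injective because `L v = 1` and `L D = 0`, surjective because every cycle `y` is `v L y` up to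
a boundary; its inverse sends the class of `y` to `L y`. -/
lemma IsHomologyOf.exists_basis {k X Y X' H a b c : Type*} [Field k] [AddCommGroup X]
    [Module k X] [AddCommGroup Y] [Module k Y] [AddCommGroup X'] [Module k X'] [AddCommGroup H]
    [Module k H] {D : X →ₗ[k] Y} {E : Y →ₗ[k] X'} {cl : LinearMap.ker E →ₗ[k] H}
    (h : IsHomologyOf D E cl) [Fintype a] [Fintype b] [Fintype c] [DecidableEq a] [DecidableEq b]
    (bX : Module.Basis a k X) (bY : Module.Basis b k Y) (bX' : Module.Basis c k X') {r : ℕ}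
    {v : Matrix b (Fin r) k} {L : Matrix (Fin r) b k}
    (hEv : LinearMap.toMatrix bY bX' E * v = 0) (hLv : L * v = 1)
    (hLD : L * LinearMap.toMatrix bX bY D = 0)
    (hvL : ∀ x, (LinearMap.toMatrix bY bX' E).mulVec x = 0 →
      ∃ y, x = v.mulVec (L.mulVec x) + (LinearMap.toMatrix bX bY D).mulVec y) :
    (∀ x, E (bY.equivFun.symm (v.mulVec x)) = 0) ∧
    ∃ e : Module.Basis (Fin r) k H, ∀ y : LinearMap.ker E,
      e.equivFun (cl y) = L.mulVec (bY.equivFun y.1) := by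
  have hDm : ∀ x, bY.equivFun (D x) = (LinearMap.toMatrix bX bY D).mulVec (bX.equivFun x) :=
    fun x => (LinearMap.toMatrix_mulVec_repr bX bY D x).symm
  have hEm : ∀ x, bX'.equivFun (E x) = (LinearMap.toMatrix bY bX' E).mulVec (bY.equivFun x) :=
    fun x => (LinearMap.toMatrix_mulVec_repr bY bX' E x).symm
  have hker : ∀ x, E (bY.equivFun.symm (v.mulVec x)) = 0 := by
    intro x
    apply bX'.equivFun.injective
    rw [hEm, LinearEquiv.apply_symm_apply, Matrix.mulVec_mulVec, hEv, Matrix.zero_mulVec, map_zero]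
  refine ⟨hker, ?_⟩
  let φ : (Fin r → k) →ₗ[k] H := cl ∘ₗ
    LinearMap.codRestrict (LinearMap.ker E) (bY.equivFun.symm.toLinearMap ∘ₗ v.mulVecLin) hker
  have hφ : ∀ y : LinearMap.ker E, φ (L.mulVec (bY.equivFun y.1)) = cl y := by
    intro y
    obtain ⟨x, hx⟩ := hvL (bY.equivFun y.1) (by rw [← hEm, y.2, map_zero])
    rw [← sub_eq_zero]
    change cl _ - cl y = 0
    rw [← map_sub, h.eq_zero_iff]
    refine ⟨-bX.equivFun.symm x, bY.equivFun.injective ?_⟩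
    rw [hDm, map_neg, LinearEquiv.apply_symm_apply, Matrix.mulVec_neg]
    change _ = bY.equivFun (bY.equivFun.symm (v.mulVec _) - y.1)
    rw [map_sub, LinearEquiv.apply_symm_apply]
    nth_rewrite 2 [hx]
    abel
  have hinj : Function.Injective φ := by
    rw [injective_iff_map_eq_zero]
    intro x hx
    obtain ⟨y, hy⟩ := (h.eq_zero_iff _).1 hx
    have h1 := congrArg bY.equivFun hy
    change _ = bY.equivFun (bY.equivFun.symm (v.mulVec x)) at h1
    rw [hDm, LinearEquiv.apply_symm_apply] at h1
    rw [← Matrix.one_mulVec x, ← hLv, ← Matrix.mulVec_mulVec, ← h1, Matrix.mulVec_mulVec, hLD,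
      Matrix.zero_mulVec]
  have hsurj : Function.Surjective φ := by
    intro x
    obtain ⟨y, rfl⟩ := h.surjective x
    exact ⟨_, hφ y⟩
  refine ⟨Module.Basis.ofEquivFun (LinearEquiv.ofBijective φ ⟨hinj, hsurj⟩).symm, fun y => ?_⟩
  rw [Module.Basis.equivFun_ofEquivFun, LinearEquiv.symm_apply_eq]
  exact (hφ y).symm

variable {k : Type u} [Field k] [IsAlgClosed k] {Z : Scheme.{u}} {p : Z ⟶ Spec (.of k)}
  [LocallyOfFiniteType p]

/-- The homology of a family of complexes with regular differentials of constant rank has local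
frames in which the regular sections are those which are locally represented by regular cycles. -/
theorem exists_frame_of_isHomologyOf {X Y X' H : closedPoints Z → Type u}
    [∀ z, AddCommGroup (X z)] [∀ z, Module k (X z)] [∀ z, AddCommGroup (Y z)]
    [∀ z, Module k (Y z)] [∀ z, AddCommGroup (X' z)] [∀ z, Module k (X' z)]
    [∀ z, AddCommGroup (H z)] [∀ z, Module k (H z)]
    {D : ∀ z, X z →ₗ[k] Y z} {E : ∀ z, Y z →ₗ[k] X' z}
    {cl : ∀ z, LinearMap.ker (E z) →ₗ[k] H z} (h : ∀ z, IsHomologyOf (D z) (E z) (cl z))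
    {a b c : Type} [Fintype a] [Fintype b] [Fintype c] [DecidableEq a] [DecidableEq b]
    (bX : ∀ z, Module.Basis a k (X z)) (bY : ∀ z, Module.Basis b k (Y z))
    (bX' : ∀ z, Module.Basis c k (X' z)) {U₀ : Z.Opens}
    (hD : IsRegularMatrix p U₀ (fun z => LinearMap.toMatrix (bX z) (bY z) (D z)))
    (hE : IsRegularMatrix p U₀ (fun z => LinearMap.toMatrix (bY z) (bX' z) (E z)))
    (hDr : ∀ z w, Module.finrank k (LinearMap.range (D z)) =
      Module.finrank k (LinearMap.range (D w)))
    (hEr : ∀ z w, Module.finrank k (LinearMap.range (E z)) =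
      Module.finrank k (LinearMap.range (E w)))
    {m : ℕ} (hm : ∀ z, Module.finrank k (H z) = m)
    (z : closedPoints Z) (hz : z.1 ∈ U₀) :
    ∃ W ≤ U₀, z.1 ∈ W ∧ ∃ e : ∀ w, Module.Basis (Fin m) k (H w), ∀ U ≤ W, ∀ s : ∀ w, H w,
      (∀ j, IsRegularOn p U (fun w => (e w).repr (s w) j)) ↔
      ∀ w : closedPoints Z, w.1 ∈ U → ∃ U' ≤ U, w.1 ∈ U' ∧ ∃ f : ∀ w, LinearMap.ker (E w),
        (∀ i, IsRegularOn p U' (fun w => (bY w).repr (f w).1 i)) ∧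
        ∀ w : closedPoints Z, w.1 ∈ U' → s w = cl w (f w) := by
  classical
  obtain ⟨W, hW, hzW, r, v, L, hv, hL, hvL⟩ := hD.exists_homology_frame hE
    (fun w _ => by
      rw [← LinearMap.toMatrix_comp, show E w ∘ₗ D w = 0 from LinearMap.ext (h w).apply_apply,
        map_zero])
    (fun z w _ _ => by simpa only [LinearMap.rank_toMatrix_eq_finrank_range] using hDr z w)
    (fun z w _ _ => by simpa only [LinearMap.rank_toMatrix_eq_finrank_range] using hEr z w) z hz
  have key : ∀ w : closedPoints Z, w.1 ∈ W → _ := fun w hw =>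
    (h w).exists_basis (bX w) (bY w) (bX' w) (hvL w hw).1 (hvL w hw).2.1 (hvL w hw).2.2.1
      (hvL w hw).2.2.2
  obtain rfl : r = m := by
    obtain ⟨-, e, -⟩ := key z hzW
    rw [← hm z, Module.finrank_eq_card_basis e, Fintype.card_fin]
  -- A frame has to be given at every closed point; outside `W` any basis of the right size will do.
  have hbasis : ∀ w, ∃ e : Module.Basis (Fin r) k (H w), w.1 ∈ W → ∀ y : LinearMap.ker (E w),
      e.equivFun (cl w y) = (L w).mulVec ((bY w).equivFun y.1) := by
    intro w
    by_cases hw : w.1 ∈ W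
    · obtain ⟨-, e, he⟩ := key w hw
      exact ⟨e, fun _ => he⟩
    · have := Module.Finite.of_basis (bY w)
      have := Module.Finite.of_surjective (cl w) (h w).surjective
      exact ⟨Module.finBasisOfFinrankEq k _ (hm w), fun h => absurd h hw⟩
  choose e he using hbasis
  refine ⟨W, hW, hzW, e, fun U hU s => ⟨fun hs w hw => ?_, fun hs j => ?_⟩⟩
  -- The representing cycle has coordinates `v` applied to those of `s`; the value `0` outside `W`
  -- is never used. In the converse direction `L` sends coordinates of a representative to those of
  -- its class.
  · let f : ∀ w, LinearMap.ker (E w) := fun w =>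
      if hw : w.1 ∈ W then
        ⟨(bY w).equivFun.symm ((v w).mulVec ((e w).equivFun (s w))), (key w hw).1 _⟩
      else 0
    have hf : ∀ w : closedPoints Z, w.1 ∈ W →
        (bY w).equivFun (f w).1 = (v w).mulVec ((e w).equivFun (s w)) := by
      intro w hw
      simp only [f, dif_pos hw, LinearEquiv.apply_symm_apply]
    refine ⟨U, le_rfl, hw, f, fun i => ?_, fun w hw => ?_⟩
    · refine IsRegularOn.congr p ((hv.mono hU).mulVec (v := fun w => (e w).equivFun (s w)) hs i)
        fun w hw => ?_
      exact (congrFun (hf w (hU hw)) i).symm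
    · apply (e w).equivFun.injective
      rw [he w (hU hw), hf w (hU hw), Matrix.mulVec_mulVec, (hvL w (hU hw)).2.1,
        Matrix.one_mulVec]
  · refine IsRegularOn.of_local p fun w hw => ?_
    obtain ⟨U', hU', hwU', f, hf, hsf⟩ := hs w hw
    refine ⟨U', hwU', ?_⟩
    refine IsRegularOn.congr p ((hL.mono (hU'.trans hU)).mulVec
      (v := fun w => (bY w).equivFun (f w).1) hf j) fun w hw => ?_
    rw [hsf w hw]
    exact (congrFun (he w (hU (hU' hw)) (f w)) j).symm

end Homology

/-! ### Families of `Ext` spaces -/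

section ExtFamilies

variable {k : Type u} [Field k] {A : Type u} [Ring A] [Algebra k A]

/-- The homomorphisms `P → V` of `A`-modules, with the `k`-linear structure of the category of
`A`-modules. -/
def HomSpace (P : ModuleCat.{u} A) (V : Type u) [AddCommGroup V] [Module A V] : Type u :=
  P ⟶ ModuleCat.of A V

instance (P : ModuleCat.{u} A) (V : Type u) [AddCommGroup V] [Module A V] :
    AddCommGroup (HomSpace P V) :=
  Preadditive.homGroup P (ModuleCat.of A V)

instance (P : ModuleCat.{u} A) (V : Type u) [AddCommGroup V] [Module A V] :
    Module k (HomSpace P V) :=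
  Linear.homModule P (ModuleCat.of A V)

variable (k) in
/-- Precomposition with a map of `A`-modules. -/
def precomp {P Q : ModuleCat.{u} A} (d : P ⟶ Q) (V : Type u) [AddCommGroup V] [Module A V] :
    HomSpace Q V →ₗ[k] HomSpace P V :=
  Linear.leftComp k (ModuleCat.of A V) d

/-- A homomorphism from a free module is given by the coordinates of the images of the basis
vectors. -/
def homBasis {P : ModuleCat.{u} A} {ι κ : Type} [Fintype ι] [Fintype κ]
    (b : Module.Basis ι A P) {V : Type u} [AddCommGroup V] [Module k V] [Module A V]
    [IsScalarTower k A V] (e : Module.Basis κ k V) :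
    Module.Basis (ι × κ) k (HomSpace P V) :=
  Module.Basis.ofEquivFun
    { toFun := fun f x => e.repr (ModuleCat.Hom.hom f (b x.1)) x.2
      invFun := fun x => ModuleCat.ofHom
        (b.constr ℕ fun i => e.equivFun.symm fun j => x (i, j))
      map_add' := fun f g => by
        ext x
        exact congrArg (fun a => a x.2)
          (map_add e.repr (ModuleCat.Hom.hom f (b x.1)) (ModuleCat.Hom.hom g (b x.1)))
      map_smul' := fun c f => by
        ext x
        have h : ModuleCat.Hom.hom (c • f) (b x.1) = c • (show V from ModuleCat.Hom.hom f (b x.1)) :=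
          algebraMap_smul A c (show V from ModuleCat.Hom.hom f (b x.1))
        exact congrArg (fun a => a x.2)
          ((congrArg e.repr h).trans (map_smul e.repr c (show V from ModuleCat.Hom.hom f (b x.1))))
      left_inv := fun f => by
        refine ModuleCat.hom_ext ?_
        refine b.ext fun i => ?_
        rw [ModuleCat.hom_ofHom, Module.Basis.constr_basis]
        exact e.equivFun.symm_apply_apply (show V from ModuleCat.Hom.hom f (b i))
      right_inv := fun x => by
        ext ⟨i, j⟩
        simp only [ModuleCat.hom_ofHom]
        erw [Module.Basis.constr_basis]
        exact congrFun (e.equivFun.apply_symm_apply fun j => x (i, j)) j }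

lemma homBasis_repr {P : ModuleCat.{u} A} {ι κ : Type} [Fintype ι] [Fintype κ]
    (b : Module.Basis ι A P) {V : Type u} [AddCommGroup V] [Module k V] [Module A V]
    [IsScalarTower k A V] (e : Module.Basis κ k V) (f : HomSpace P V) (i : ι) (j : κ) :
    (homBasis b e).repr f (i, j) = e.repr (ModuleCat.Hom.hom f (b i)) j := rfl

variable [IsAlgClosed k] {Z : Scheme.{u}} {p : Z ⟶ Spec (.of k)}
  [LocallyOfFiniteType p] {V : closedPoints Z → Type u} [∀ z, AddCommGroup (V z)]
  [∀ z, Module k (V z)] [∀ z, Module A (V z)] [∀ z, IsScalarTower k A (V z)]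

/-- Expanding `x` in the basis gives `f_z(x) = ∑ a_j f_z(b_j)` with `a_j ∈ A` independent of `z`,
and the action of each `a_j` is regular. Thus regularity need only be tested on a basis. -/
lemma isRegularOn_hom_apply (E : ModuleFamily p A V) {U : Z.Opens} {i : E.index}
    (hU : U ≤ E.chart i) {P : ModuleCat.{u} A} {ι : Type} [Fintype ι] (b : Module.Basis ι A P)
    (f : ∀ z, HomSpace P (V z))
    (hf : ∀ j c, IsRegularOn p U fun z => (E.frame i z).repr (ModuleCat.Hom.hom (f z) (b j)) c)
    (x : P)
    (c : Fin E.rank) :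
    IsRegularOn p U fun z => (E.frame i z).repr (ModuleCat.Hom.hom (f z) x) c := by
  have h1 : (fun z => (E.frame i z).repr (ModuleCat.Hom.hom (f z) x) c) =
      ∑ j, fun z =>
        (E.frame i z).repr (b.repr x j • (show V z from ModuleCat.Hom.hom (f z) (b j))) c := by
    ext z
    have h2 : ModuleCat.Hom.hom (f z) x =
        ∑ j, b.repr x j • (show V z from ModuleCat.Hom.hom (f z) (b j)) := by
      conv_lhs => rw [← b.sum_repr x]
      rw [map_sum]
      exact Finset.sum_congr rfl fun j _ => map_smul (ModuleCat.Hom.hom (f z)) _ _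
    rw [h2, map_sum]
    simp
  rw [h1, ← mem_regularFunctions]
  exact sum_mem fun j _ => E.isRegularOn_smul hU (b.repr x j) _ (hf j) c

/-- The entries are coordinates of `f_z(d b)`, where `f_z` is a basis homomorphism: it has constant
coordinates on the basis of `Q`, so `isRegularOn_hom_apply` applies. -/
lemma isRegularMatrix_precomp (E : ModuleFamily p A V) (i : E.index) {P Q : ModuleCat.{u} A}
    {ι κ : Type} [Fintype ι] [Fintype κ] [DecidableEq ι] [DecidableEq κ] (bP : Module.Basis ι A P)
    (bQ : Module.Basis κ A Q) (d : P ⟶ Q) :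
    IsRegularMatrix p (E.chart i) fun z =>
      LinearMap.toMatrix (homBasis bQ (E.frame i z)) (homBasis bP (E.frame i z))
        (precomp k d (V z)) := by
  rintro ⟨i₁, c₁⟩ ⟨i₂, c₂⟩
  simp only [LinearMap.toMatrix_apply, homBasis_repr]
  refine isRegularOn_hom_apply E le_rfl bQ (fun z => homBasis bQ (E.frame i z) (i₂, c₂))
    (fun j c => ?_) (d.hom (bP i₁)) c₁
  refine IsRegularOn.congr p (f := fun _ => Finsupp.single (i₂, c₂) (1 : k) (j, c))
    ((regularFunctions p (E.chart i)).algebraMap_mem _) fun z _ => ?_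
  rw [← Module.Basis.repr_self (homBasis bQ (E.frame i z))]
  rfl

end ExtFamilies

/-! ### Ext as the cohomology of the complex of homomorphisms -/

section ExtClasses

-- As a cochain complex the resolution lives in degrees `≤ 0`, so the differential from degree `0`
-- to degree `1` vanishes and so does every coboundary.
open CochainComplex HomComplex in
lemma CategoryTheory.ProjectiveResolution.extMk_eq_zero_iff_of_degree_zero {C : Type*} [Category* C]
    [Abelian C] [HasExt.{u} C] {X Y : C} (R : ProjectiveResolution X) (f : R.complex.X 0 ⟶ Y)
    (hf : R.complex.d 1 0 ≫ f = 0) : R.extMk f 1 rfl hf = 0 ↔ f = 0 := by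
  refine ⟨fun h => ?_, fun h => by subst h; exact R.extMk_zero 1 rfl⟩
  rw [← R.extEquivCohomologyClass.apply_eq_iff_eq, R.extEquivCohomologyClass_extMk,
    R.extEquivCohomologyClass_zero, CohomologyClass.mk_eq_zero_iff,
    Cocycle.toSingleMk_mem_coboundaries_iff _ _ _ _ _ 1 (by simp)] at h
  obtain ⟨g, hg⟩ := h
  have h0 : R.cochainComplex.d (-(0 : ℕ)) 1 = 0 :=
    (CochainComplex.isZero_of_isStrictlyLE R.cochainComplex 0 1 (by lia)).eq_of_tgt _ _
  rw [h0, Limits.zero_comp] at hg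
  rw [← cancel_epi (R.cochainComplexXIso (-(0 : ℕ)) 0 rfl).hom, ← hg, Limits.comp_zero]

/-- Truncated subtraction covers all degrees at once: for `n = 0` the map is `d 0 0 = 0`, and the
right side says `f = 0`. -/
lemma CategoryTheory.ProjectiveResolution.extMk_eq_zero_iff_exists {C : Type*} [Category* C]
    [Abelian C] [HasExt.{u} C] {X Y : C} (R : ProjectiveResolution X) {n : ℕ}
    (f : R.complex.X n ⟶ Y) (hf : R.complex.d (n + 1) n ≫ f = 0) :
    R.extMk f (n + 1) rfl hf = 0 ↔ ∃ g : R.complex.X (n - 1) ⟶ Y, R.complex.d n (n - 1) ≫ g = f := by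
  cases n with
  | zero =>
    rw [R.extMk_eq_zero_iff_of_degree_zero]
    have h0 : R.complex.d 0 (0 - 1) = 0 := R.complex.shape _ _ (by simp)
    rw [h0]
    simp [eq_comm]
  | succ n => exact R.extMk_eq_zero_iff f _ rfl hf n rfl

lemma CategoryTheory.ProjectiveResolution.smul_extMk {k C : Type*} [Field k] [Category* C]
    [Abelian C] [Linear k C] [HasExt.{u} C] {X Y : C} (R : ProjectiveResolution X) {n : ℕ} (c : k)
    (f : R.complex.X n ⟶ Y) (hf : R.complex.d (n + 1) n ≫ f = 0) :
    c • R.extMk f (n + 1) rfl hf =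
      R.extMk (c • f) (n + 1) rfl (by rw [Linear.comp_smul, hf, smul_zero]) := by
  rw [Abelian.Ext.smul_eq_comp_mk₀, R.extMk_comp_mk₀]
  congr 1
  rw [Linear.comp_smul, Category.comp_id]

variable {k : Type u} [Field k] {A : Type u} [Ring A] [Algebra k A] {T : Type u}
  [AddCommGroup T] [Module A T]

variable (k) (B : Type u) in
/-- The class in `Ext_A^n(T, V)` of a cocycle in `Hom_A(P_n, V)`. -/
def extClass (P : ProjectiveResolution (ModuleCat.of A T)) (n : ℕ) (V : Type u) [AddCommGroup V]
    [Module A V] : LinearMap.ker (precomp k (P.complex.d (n + 1) n) V) →ₗ[k] ExtMod A B T V n where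
  toFun f := P.extMk f.1 (n + 1) rfl f.2
  map_add' f g := (P.add_extMk f.1 g.1 (n + 1) rfl f.2 g.2).symm
  map_smul' c f := (P.smul_extMk c f.1 f.2).symm

lemma isHomologyOf_extClass {B : Type u} (P : ProjectiveResolution (ModuleCat.of A T)) (n : ℕ)
    (V : Type u) [AddCommGroup V] [Module A V] :
    IsHomologyOf (precomp k (P.complex.d n (n - 1)) V) (precomp k (P.complex.d (n + 1) n) V)
      (extClass k B P n V) where
  apply_apply f := by
    change P.complex.d (n + 1) n ≫ P.complex.d n (n - 1) ≫ f = 0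
    exact (Category.assoc _ _ _).symm.trans
      ((congrArg (· ≫ (show _ ⟶ ModuleCat.of A V from f)) (P.complex.d_comp_d _ _ _)).trans
        Limits.zero_comp)
  surjective x := by
    obtain ⟨f, hf, h⟩ := P.extMk_surjective x (n + 1) rfl
    exact ⟨⟨f, hf⟩, h⟩
  eq_zero_iff f := P.extMk_eq_zero_iff_exists f.1 f.2

end ExtClasses

/-! ### Functoriality and independence of the resolution for Ext -/

section ExtResolutions

variable {k : Type u} [Field k] [IsAlgClosed k] {A : Type u} [Ring A] {T : Type u}
  [AddCommGroup T] [Module A T] {Z : Scheme.{u}} {p : Z ⟶ Spec (.of k)}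
  [LocallyOfFiniteType p] {V : closedPoints Z → Type u} [∀ z, AddCommGroup (V z)]
  [∀ z, Module k (V z)] [∀ z, Module A (V z)] {B : Type u}

/-- Regularity of a family of classes is preserved by the maps induced by endomorphisms of `T`,
and does not depend on the resolution. -/
lemma IsRegularExtFamily.mk₀_comp {E : AlgVectorBundle p V}
    {P P' : ProjectiveResolution (ModuleCat.of A T)} {n : ℕ} {U : Z.Opens}
    {s : ∀ z, ExtMod A B T (V z) n} (hs : IsRegularExtFamily E P n U s)
    (g : ModuleCat.of A T ⟶ ModuleCat.of A T) :
    IsRegularExtFamily (B := B) E P' n U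
      (fun z => (Abelian.Ext.mk₀ g).comp (s z) (zero_add n)) := by
  -- This chain map does not depend on `z`, so composing with it evaluates the same regular family
  -- at the fixed element `φ(x)`.
  let φ : ProjectiveResolution.Hom P' P g :=
    { hom := ProjectiveResolution.lift g P' P
      hom_f_zero_comp_π_f_zero := by
        rw [ProjectiveResolution.lift_commutes_zero]
        rfl }
  intro z hz
  obtain ⟨W, hW, hzW, f, hf, hreg, hsf⟩ := hs z hz
  refine ⟨W, hW, hzW, fun w => φ.hom.f n ≫ f w, fun w => ?_, fun x => ?_, fun w hw => ?_⟩
  · rw [← Category.assoc, ← φ.hom.comm, Category.assoc, hf, Limits.comp_zero]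
  · exact hreg ((φ.hom.f n).hom x)
  · exact (congrArg (fun x => (Abelian.Ext.mk₀ g).comp x (zero_add n)) (hsf w hw)).trans
      (ProjectiveResolution.mk₀_comp_extMk (f w) (n + 1) rfl (hf w) φ)

lemma isRegularExtFamily_iff_of_resolutions {E : AlgVectorBundle p V}
    (P P' : ProjectiveResolution (ModuleCat.of A T)) {n : ℕ} {U : Z.Opens}
    {s : ∀ z, ExtMod A B T (V z) n} :
    IsRegularExtFamily E P n U s ↔ IsRegularExtFamily E P' n U s := by
  have h (x : ∀ z, ExtMod A B T (V z) n) :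
      (fun z => (Abelian.Ext.mk₀ (𝟙 (ModuleCat.of A T))).comp (x z) (zero_add n)) = x :=
    funext fun z => Abelian.Ext.mk₀_id_comp (x z)
  exact ⟨fun hs => h s ▸ hs.mk₀_comp (P' := P') (𝟙 _),
    fun hs => h s ▸ hs.mk₀_comp (P' := P) (𝟙 _)⟩

end ExtResolutions

/-- Here `h`, `ρ`, `x` stand for homology dimensions, ranks of differentials and dimensions of
terms. The relation determines `ρ (l + 1)` from `ρ l` and `h l`, so control of `h` up to `n` reaches
`ρ (n + 1)`. -/
lemma rank_eq_of_recurrence {S : Type*} {h ρ : ℕ → S → ℕ} {x : ℕ → ℕ} {n : ℕ} (h0 : ∀ z, ρ 0 z = 0)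
    (hn : ∀ l ≤ n, ∃ m, ∀ z, h l z = m) (hρ : ∀ l z, h l z + ρ l z + ρ (l + 1) z = x l) :
    ∀ l ≤ n + 1, ∀ z w, ρ l z = ρ l w := by
  intro l
  induction l with
  | zero => intro _ z w; rw [h0, h0]
  | succ l ih =>
    intro hl z w
    obtain ⟨m, hm⟩ := hn l (by omega)
    have h1 := hρ l z
    have h2 := hρ l w
    have h3 := ih (by omega) z w
    have h4 := hm z
    have h5 := hm w
    omega

/-! ### Part (1): Ext in families -/

section ExtTheorem

variable {k : Type u} [Field k] [IsAlgClosed k] {A B T : Type u} [Ring A] [Algebra k A]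
  [Module.Finite k A] [Ring B] [Algebra k B]
  [AddCommGroup T] [Module k T] [Module.Finite k T] [Module A T] [Module Bᵐᵒᵖ T]
  [SMulCommClass A Bᵐᵒᵖ T] [IsScalarTower k A T] [IsScalarTower k Bᵐᵒᵖ T]
  {Z : Scheme.{u}} {p : Z ⟶ Spec (.of k)} [LocallyOfFiniteType p]

theorem exists_moduleFamily_ext (n : ℕ) (V : closedPoints Z → Type u) [∀ z, AddCommGroup (V z)]
    [∀ z, Module k (V z)] [∀ z, Module A (V z)] [∀ z, IsScalarTower k A (V z)]
    (E : ModuleFamily p A V)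
    (hE : ∀ l ≤ n, ∃ m : ℕ, ∀ z, Module.finrank k (ExtMod A B T (V z) l) = m) :
    ∃ F : ModuleFamily p B (fun z => ExtMod A B T (V z) n),
      ∀ P : ProjectiveResolution (ModuleCat.of A T),
        ∀ (U : Z.Opens) (s : ∀ z, ExtMod A B T (V z) n),
          F.IsRegularSection U s ↔ IsRegularExtFamily E.toAlgVectorBundle P n U s := by
  have : IsNoetherianRing A := IsNoetherianRing.of_finite k A
  have : Module.Finite A T := Module.Finite.of_restrictScalars_finite k A T
  let M := FGModuleCat.of A T
  let Q : ProjectiveResolution (ModuleCat.of A T) := FiniteFreeResolution.resolution M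
  let bQ (l : ℕ) : Module.Basis _ A (Q.complex.X l) := FiniteFreeResolution.resolutionBasis M l
  have hfin (z : closedPoints Z) (l : ℕ) : Module.finrank k (HomSpace (Q.complex.X l) (V z)) =
      FiniteFreeResolution.coverRank (FiniteFreeResolution.syzygy M l) * E.rank := by
    obtain ⟨i, -⟩ := E.covers z
    rw [Module.finrank_eq_card_basis (homBasis (bQ l) (E.frame i z))]
    simp
  have hfinite (z : closedPoints Z) (l : ℕ) : Module.Finite k (HomSpace (Q.complex.X l) (V z)) := by
    obtain ⟨i, -⟩ := E.covers z
    exact Module.Finite.of_basis (homBasis (bQ l) (E.frame i z))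
  have hrank : ∀ l ≤ n + 1, ∀ z w : closedPoints Z,
      Module.finrank k (LinearMap.range (precomp k (Q.complex.d l (l - 1)) (V z))) =
      Module.finrank k (LinearMap.range (precomp k (Q.complex.d l (l - 1)) (V w))) := by
    refine rank_eq_of_recurrence (h := fun l z => Module.finrank k (ExtMod A B T (V z) l))
      (fun z => ?_) hE (fun l z =>
        (isHomologyOf_extClass (B := B) Q l (V z)).finrank_add_rank_add_rank.trans (hfin z l))
    -- Since `0 - 1 = 0`, this is `d 0 0`, which is not an arrow of the complex shape.
    have : precomp k (Q.complex.d 0 (0 - 1)) (V z) = 0 := by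
      rw [Q.complex.shape _ _ (by simp)]
      exact LinearMap.ext fun f => Limits.zero_comp (f := (show _ ⟶ ModuleCat.of A (V z) from f))
    rw [this, LinearMap.range_zero, finrank_bot]
  obtain ⟨m, hm⟩ := hE n le_rfl
  suffices h : ∃ F : ModuleFamily p B (fun z => ExtMod A B T (V z) n), ∀ U s,
      F.IsRegularSection U s ↔ IsRegularExtFamily E.toAlgVectorBundle Q n U s by
    obtain ⟨F, hF⟩ := h
    exact ⟨F, fun P U s => (hF U s).trans (isRegularExtFamily_iff_of_resolutions Q P)⟩
  refine exists_moduleFamily (fun U s => IsRegularExtFamily E.toAlgVectorBundle Q n U s)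
    ?_ ?_ m ?_ ?_
  · intro U W s hWU hs z hz
    obtain ⟨W', hW', hz', f, hf, hreg, hsf⟩ := hs z (hWU hz)
    exact ⟨W' ⊓ W, inf_le_right, ⟨hz', hz⟩, f, hf,
      fun x i a => (hreg x i a).mono p (inf_le_inf_right _ inf_le_left), fun w hw => hsf w hw.1⟩
  · intro U s hs z hz
    obtain ⟨W, hW, hzW, h⟩ := hs z hz
    obtain ⟨W', hW', hz', h'⟩ := h z hzW
    exact ⟨W', hW'.trans hW, hz', h'⟩
  · intro z
    obtain ⟨i, hi⟩ := E.covers z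
    -- Precomposition reverses arrows: the incoming map starts at degree `n - 1` and the outgoing
    -- one ends at degree `n + 1`. For `n = 0` the incoming map is zero.
    obtain ⟨W, hW, hzW, e, he⟩ := exists_frame_of_isHomologyOf (p := p)
      (fun w => isHomologyOf_extClass (k := k) (B := B) Q n (V w))
      (fun w => homBasis (bQ (n - 1)) (E.frame i w)) (fun w => homBasis (bQ n) (E.frame i w))
      (fun w => homBasis (bQ (n + 1)) (E.frame i w)) (isRegularMatrix_precomp E i _ _ _)
      (isRegularMatrix_precomp E i _ _ _) (hrank n (by omega)) (hrank (n + 1) le_rfl) hm z hi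
    refine ⟨W, hzW, e, fun U hU s => ?_⟩
    rw [he U hU s]
    have hchart : ∀ {U' : Z.Opens}, U' ≤ U → U' ≤ E.chart i := fun h => h.trans (hU.trans hW)
    constructor
    · intro hs w hw
      obtain ⟨U', hU', hwU', f, hf, hreg, hsf⟩ := hs w hw
      exact ⟨U', hU', hwU', fun w => ⟨f w, hf w⟩, fun ⟨j, c⟩ =>
        (E.isRegularSection_iff_of_le (hchart hU') _).1 (hreg (bQ n j)) c, hsf⟩
    · intro hs w hw
      obtain ⟨U', hU', hwU', f, hreg, hsf⟩ := hs w hw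
      exact ⟨U', hU', hwU', fun w => (f w).1, fun w => (f w).2, fun x =>
        (E.isRegularSection_iff_of_le (hchart hU') _).2 fun c =>
          isRegularOn_hom_apply E (hchart hU') (bQ n) (fun w => (f w).1)
            (fun j c => hreg (j, c)) x c, hsf⟩
  · intro b U s hs
    exact hs.mk₀_comp (rightMulHom A T b)

end ExtTheorem

/-! ### Families of `Tor` spaces -/

section TensorBasis

open scoped ModuleCat

variable {k : Type u} [Field k] {B : Type u} [Ring B] [Algebra k B] {W : Type u} [AddCommGroup W]
  [Module k W] [Module B W]

variable (k W) in
/-- The class of `x ⊗ w`, as a linear map in `w`. -/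
def balancedTmulRight (N : ModuleCat.{u} Bᵐᵒᵖ) (x : N) : W →ₗ[k] (tensorFunctor k B W).obj N :=
  (balancedRelations k B N W).mkQ ∘ₗ TensorProduct.mk k N W x

lemma balancedTmul_smul (N : ModuleCat.{u} Bᵐᵒᵖ) (x : N) (a : Bᵐᵒᵖ) (w : W) :
    balancedTmul k B W N (a • x) w = balancedTmul k B W N x (a.unop • w) :=
  (Submodule.Quotient.eq _).2 (Submodule.subset_span ⟨a.unop, x, w, rfl⟩)

lemma balancedTmul_sum (N : ModuleCat.{u} Bᵐᵒᵖ) {ι : Type} [Fintype ι] (x : ι → N) (w : W) :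
    balancedTmul k B W N (∑ i, x i) w = ∑ i, balancedTmul k B W N (x i) w :=
  map_sum ((balancedRelations k B N W).mkQ ∘ₗ (TensorProduct.mk k N W).flip w) _ _

/-- The element of `N ⊗_B W` with given coordinates, where `N` is free. -/
def tensorOfCoords {N : ModuleCat.{u} Bᵐᵒᵖ} {ι κ : Type} [Fintype ι] [Fintype κ]
    (b : Module.Basis ι Bᵐᵒᵖ N) (e : Module.Basis κ k W) :
    (ι × κ → k) →ₗ[k] (tensorFunctor k B W).obj N :=
  ∑ i, balancedTmulRight k W N (b i) ∘ₗ e.equivFun.symm.toLinearMap ∘ₗ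
    LinearMap.funLeft k k (fun j => (i, j))

lemma tensorOfCoords_apply {N : ModuleCat.{u} Bᵐᵒᵖ} {ι κ : Type} [Fintype ι] [Fintype κ]
    (b : Module.Basis ι Bᵐᵒᵖ N) (e : Module.Basis κ k W) (x : ι × κ → k) :
    tensorOfCoords b e x =
      ∑ i, balancedTmul k B W N (b i) (e.equivFun.symm fun j => x (i, j)) := by
  rw [tensorOfCoords, LinearMap.sum_apply]
  rfl

variable [IsScalarTower k B W]

/-- The coordinates of an element of `N ⊗_B W`, where `N` is free. -/
def tensorCoords {N : ModuleCat.{u} Bᵐᵒᵖ} {ι κ : Type} [Fintype ι] [Fintype κ]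
    (b : Module.Basis ι Bᵐᵒᵖ N) (e : Module.Basis κ k W) :
    (tensorFunctor k B W).obj N →ₗ[k] (ι × κ → k) :=
  Submodule.liftQ _ (TensorProduct.lift (LinearMap.mk₂ k
    (fun x w (i : ι × κ) => e.repr ((b.repr x i.1).unop • w) i.2)
    (fun x y w => by ext i; simp [add_smul])
    (fun c x w => by
      ext i
      have h : b.repr (c • x) i.1 = c • b.repr x i.1 := by
        change b.repr (algebraMap k Bᵐᵒᵖ c • x) i.1 = _
        rw [map_smul, Finsupp.smul_apply, algebraMap_smul]
      simp [h])
    (fun x w w' => by ext i; simp)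
    (fun c x w => by ext i; simp [smul_comm _ c]))) <| by
  rw [balancedRelations, Submodule.span_le]
  rintro _ ⟨a, x, w, rfl⟩
  rw [SetLike.mem_coe, LinearMap.mem_ker, map_sub, sub_eq_zero]
  ext i
  simp [mul_smul]

lemma tensorCoords_balancedTmul {N : ModuleCat.{u} Bᵐᵒᵖ} {ι κ : Type} [Fintype ι] [Fintype κ]
    (b : Module.Basis ι Bᵐᵒᵖ N) (e : Module.Basis κ k W) (x : N) (w : W) (i : ι) (j : κ) :
    tensorCoords b e (balancedTmul k B W N x w) (i, j) = e.repr ((b.repr x i).unop • w) j := rfl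

/-- Writing `x = ∑ b_i a_i`, the balancing relation gives `x ⊗ w = ∑ b_i ⊗ a_i w`. -/
lemma tensorOfCoords_tensorCoords {N : ModuleCat.{u} Bᵐᵒᵖ} {ι κ : Type} [Fintype ι] [Fintype κ]
    (b : Module.Basis ι Bᵐᵒᵖ N) (e : Module.Basis κ k W) (x : N) (w : W) :
    tensorOfCoords b e (tensorCoords b e (balancedTmul k B W N x w)) =
      balancedTmul k B W N x w := by
  have h (i : ι) : (e.equivFun.symm fun j => tensorCoords b e (balancedTmul k B W N x w) (i, j)) =
      (b.repr x i).unop • w :=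
    e.equivFun.symm_apply_apply ((b.repr x i).unop • w)
  simp only [tensorOfCoords_apply, h, ← balancedTmul_smul]
  rw [← balancedTmul_sum, b.sum_repr]

lemma tensorCoords_tensorOfCoords {N : ModuleCat.{u} Bᵐᵒᵖ} {ι κ : Type} [Fintype ι] [Fintype κ]
    (b : Module.Basis ι Bᵐᵒᵖ N) (e : Module.Basis κ k W) (x : ι × κ → k) :
    tensorCoords b e (tensorOfCoords b e x) = x := by
  classical
  ext ⟨i, j⟩
  rw [tensorOfCoords_apply, map_sum, Finset.sum_apply, Finset.sum_eq_single i]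
  · rw [tensorCoords_balancedTmul, Module.Basis.repr_self, Finsupp.single_eq_same,
      MulOpposite.unop_one, one_smul]
    exact congrFun (e.equivFun.apply_symm_apply fun j => x (i, j)) j
  · intro l _ hl
    rw [tensorCoords_balancedTmul, Module.Basis.repr_self, Finsupp.single_eq_of_ne hl.symm,
      MulOpposite.unop_zero, zero_smul, map_zero, Finsupp.zero_apply]
  · intro h
    exact absurd (Finset.mem_univ i) h

/-- A basis of `N ⊗_B W`, where `N` is free. -/
def tensorBasis {N : ModuleCat.{u} Bᵐᵒᵖ} {ι κ : Type} [Fintype ι] [Fintype κ]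
    (b : Module.Basis ι Bᵐᵒᵖ N) (e : Module.Basis κ k W) :
    Module.Basis (ι × κ) k ((tensorFunctor k B W).obj N) :=
  Module.Basis.ofEquivFun <| LinearEquiv.ofLinearMap (tensorCoords b e) (tensorOfCoords b e)
    (LinearMap.ext (tensorCoords_tensorOfCoords b e))
    (Submodule.linearMap_qext _ (TensorProduct.ext' (tensorOfCoords_tensorCoords b e)))

lemma tensorBasis_apply {N : ModuleCat.{u} Bᵐᵒᵖ} {ι κ : Type} [Fintype ι] [Fintype κ]
    (b : Module.Basis ι Bᵐᵒᵖ N) (e : Module.Basis κ k W) (i : ι) (j : κ) :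
    tensorBasis b e (i, j) = balancedTmul k B W N (b i) (e j) := by
  classical
  apply (tensorBasis b e).repr.injective
  ext ⟨i', j'⟩
  rw [Module.Basis.repr_self]
  change _ = e.repr ((b.repr (b i) i').unop • e j) j'
  rw [Module.Basis.repr_self]
  by_cases h : i = i'
  · subst h
    simp [Finsupp.single_apply]
  · simp [h]

lemma tensorBasis_repr {N : ModuleCat.{u} Bᵐᵒᵖ} {ι κ : Type} [Fintype ι] [Fintype κ]
    (b : Module.Basis ι Bᵐᵒᵖ N) (e : Module.Basis κ k W) (x : N) (w : W) (i : ι) (j : κ) :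
    (tensorBasis b e).repr (balancedTmul k B W N x w) (i, j) =
      e.repr ((b.repr x i).unop • w) j := rfl

end TensorBasis

/-! ### Elements of the homology of a complex of vector spaces -/

section ComplexHomology

variable {k : Type u} [Field k]

/-- No arrow leaves degree `0`, and `next` then returns `0` itself, in agreement with truncated
subtraction. -/
lemma ChainComplex.next_nat_eq_sub_one (n : ℕ) : (ComplexShape.down ℕ).next n = n - 1 := by
  cases n <;> simp

/-- The cycles of a complex of vector spaces, as elements of the kernel of the differential. -/
def kerToCycles (K : ChainComplex (ModuleCat.{u} k) ℕ) (n : ℕ) :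
    ModuleCat.of k (LinearMap.ker (K.d n (n - 1)).hom) ⟶ K.cycles n :=
  K.liftCycles (ModuleCat.ofHom (LinearMap.ker (K.d n (n - 1)).hom).subtype) (n - 1)
    (ChainComplex.next_nat_eq_sub_one n) (ModuleCat.hom_ext (LinearMap.ext fun x => x.2))

lemma iCycles_kerToCycles (K : ChainComplex (ModuleCat.{u} k) ℕ) (n : ℕ)
    (x : LinearMap.ker (K.d n (n - 1)).hom) :
    (K.iCycles n).hom ((kerToCycles K n).hom x) = x.1 :=
  LinearMap.congr_fun (congrArg ModuleCat.Hom.hom (K.liftCycles_i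
    (ModuleCat.ofHom (LinearMap.ker (K.d n (n - 1)).hom).subtype) (n - 1)
    (ChainComplex.next_nat_eq_sub_one n) (ModuleCat.hom_ext (LinearMap.ext fun x => x.2)))) x

lemma iCycles_injective (K : ChainComplex (ModuleCat.{u} k) ℕ) (n : ℕ) :
    Function.Injective (K.iCycles n).hom :=
  (ModuleCat.mono_iff_injective _).1 inferInstance

lemma d_iCycles (K : ChainComplex (ModuleCat.{u} k) ℕ) (n : ℕ) (y : K.cycles n) :
    (K.d n (n - 1)).hom ((K.iCycles n).hom y) = 0 :=
  congrArg (fun f => f.hom y) (K.iCycles_d n (n - 1))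

lemma kerToCycles_iCycles (K : ChainComplex (ModuleCat.{u} k) ℕ) (n : ℕ) (y : K.cycles n) :
    (kerToCycles K n).hom ⟨(K.iCycles n).hom y, d_iCycles K n y⟩ = y :=
  iCycles_injective K n (iCycles_kerToCycles K n _)

/-- Homology is the cokernel of `toCycles`, and `iCycles` is injective, so the condition can be read
inside the complex. -/
lemma homologyπ_eq_zero_iff (K : ChainComplex (ModuleCat.{u} k) ℕ) (n : ℕ) (y : K.cycles n) :
    (K.homologyπ n).hom y = 0 ↔ ∃ x, (K.d (n + 1) n).hom x = (K.iCycles n).hom y := by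
  have hx : (ShortComplex.mk _ _ (K.toCycles_comp_homologyπ (n + 1) n)).Exact :=
    ShortComplex.exact_of_g_is_cokernel _ (K.homologyIsCokernel (n + 1) n (by simp))
  have hi (x) : (K.iCycles n).hom ((K.toCycles (n + 1) n).hom x) = (K.d (n + 1) n).hom x :=
    congrArg (fun f => f.hom x) (K.toCycles_i (n + 1) n)
  constructor
  · intro h
    obtain ⟨x, hx⟩ := (ShortComplex.moduleCat_exact_iff _).1 hx y h
    exact ⟨x, (hi x).symm.trans (congrArg (K.iCycles n).hom hx)⟩
  · rintro ⟨x, h⟩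
    have : (K.toCycles (n + 1) n).hom x = y := iCycles_injective K n ((hi x).trans h)
    rw [← this]
    exact congrArg (fun f => f.hom x) (K.toCycles_comp_homologyπ (n + 1) n)

lemma homologyπ_surjective (K : ChainComplex (ModuleCat.{u} k) ℕ) (n : ℕ) :
    Function.Surjective (K.homologyπ n).hom :=
  (ModuleCat.epi_iff_surjective _).1 inferInstance

end ComplexHomology

/-! ### Tor as the homology of the tensored resolution -/

section TorClasses

variable {k : Type u} [Field k] {B : Type u} [Ring B] [Algebra k B] {T : Type u}
  [AddCommGroup T] [Module Bᵐᵒᵖ T]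

variable (k) in
/-- The map `N ⊗_B W → N' ⊗_B W` induced by a map of right `B`-modules. -/
def tensorMap {N N' : ModuleCat.{u} Bᵐᵒᵖ} (d : N ⟶ N') (W : Type u) [AddCommGroup W] [Module k W]
    [Module B W] : (tensorFunctor k B W).obj N →ₗ[k] (tensorFunctor k B W).obj N' :=
  ((tensorFunctor k B W).map d).hom

lemma tensorMap_balancedTmul {N N' : ModuleCat.{u} Bᵐᵒᵖ} (d : N ⟶ N') (W : Type u)
    [AddCommGroup W] [Module k W] [Module B W] (x : N) (w : W) :
    tensorMap k d W (balancedTmul k B W N x w) = balancedTmul k B W N' (d.hom x) w := rfl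

variable (k) in
/-- The complex `P ⊗_B W`. -/
abbrev tensorComplex (P : ProjectiveResolution (ModuleCat.of Bᵐᵒᵖ T)) (W : Type u)
    [AddCommGroup W] [Module k W] [Module B W] : ChainComplex (ModuleCat.{u} k) ℕ :=
  ((tensorFunctor k B W).mapHomologicalComplex _).obj P.complex

variable (k) in
/-- The class in `Tor_n^B(T, W)` of a cycle in `P_n ⊗_B W`. -/
def torClass (A : Type u) (P : ProjectiveResolution (ModuleCat.of Bᵐᵒᵖ T)) (n : ℕ) (W : Type u)
    [AddCommGroup W] [Module k W] [Module B W] :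
    LinearMap.ker (tensorMap k (P.complex.d n (n - 1)) W) →ₗ[k] TorMod k A B T W n :=
  (kerToCycles (tensorComplex k P W) n ≫ (tensorComplex k P W).homologyπ n ≫
    (P.isoLeftDerivedObj (tensorFunctor k B W) n).inv).hom

lemma isoLeftDerivedObj_inv_bijective (P : ProjectiveResolution (ModuleCat.of Bᵐᵒᵖ T)) (n : ℕ)
    (W : Type u) [AddCommGroup W] [Module k W] [Module B W] :
    Function.Bijective (P.isoLeftDerivedObj (tensorFunctor k B W) n).inv.hom :=
  ConcreteCategory.bijective_of_isIso (P.isoLeftDerivedObj (tensorFunctor k B W) n).inv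

lemma isHomologyOf_torClass {A : Type u} (P : ProjectiveResolution (ModuleCat.of Bᵐᵒᵖ T)) (n : ℕ)
    (W : Type u) [AddCommGroup W] [Module k W] [Module B W] :
    IsHomologyOf (tensorMap k (P.complex.d (n + 1) n) W)
      (tensorMap k (P.complex.d n (n - 1)) W) (torClass k A P n W) where
  apply_apply x :=
    congrArg (fun f => f.hom x) ((tensorComplex k P W).d_comp_d (n + 1) n (n - 1))
  surjective x := by
    obtain ⟨y, rfl⟩ := (isoLeftDerivedObj_inv_bijective P n W).2 x
    obtain ⟨y, rfl⟩ := homologyπ_surjective _ n y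
    exact ⟨⟨((tensorComplex k P W).iCycles n).hom y, d_iCycles _ n y⟩,
      congrArg (fun y => (P.isoLeftDerivedObj (tensorFunctor k B W) n).inv.hom
        (((tensorComplex k P W).homologyπ n).hom y)) (kerToCycles_iCycles _ n y)⟩
  eq_zero_iff y := by
    have h1 : torClass k A P n W y = 0 ↔ ((tensorComplex k P W).homologyπ n).hom
        ((kerToCycles (tensorComplex k P W) n).hom y) = 0 :=
      map_eq_zero_iff (P.isoLeftDerivedObj (tensorFunctor k B W) n).inv.hom
        (isoLeftDerivedObj_inv_bijective P n W).1
    have h2 := iCycles_kerToCycles (tensorComplex k P W) n y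
    rw [h1, homologyπ_eq_zero_iff]
    exact exists_congr fun x => Eq.congr_right h2

/-- By injectivity of `iCycles` the cycle over `c` is unique, so the existential in `RepresentsTor`
reduces to membership in a kernel and an equation. -/
lemma representsTor_iff {A : Type u} (P : ProjectiveResolution (ModuleCat.of Bᵐᵒᵖ T)) (n : ℕ)
    {W : Type u} [AddCommGroup W] [Module k W] [Module B W]
    (c : (tensorFunctor k B W).obj (P.complex.X n)) (x : TorMod k A B T W n) :
    RepresentsTor A P n c x ↔ ∃ h : tensorMap k (P.complex.d n (n - 1)) W c = 0,
      x = torClass k A P n W ⟨c, h⟩ := by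
  constructor
  · rintro ⟨y, rfl, rfl⟩
    exact ⟨d_iCycles (tensorComplex k P W) n y,
      congrArg (fun y => (P.isoLeftDerivedObj (tensorFunctor k B W) n).inv.hom
        (((tensorComplex k P W).homologyπ n).hom y)) (kerToCycles_iCycles _ n y).symm⟩
  · rintro ⟨h, rfl⟩
    exact ⟨(kerToCycles (tensorComplex k P W) n).hom ⟨c, h⟩,
      iCycles_kerToCycles (tensorComplex k P W) n ⟨c, h⟩, rfl⟩

/-- Naturality of `isoLeftDerivedObj` with respect to a lift of `g`, together with naturality of
cycles and of the projection to homology. -/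
lemma RepresentsTor.map {A : Type u} {P P' : ProjectiveResolution (ModuleCat.of Bᵐᵒᵖ T)} {n : ℕ}
    {W : Type u} [AddCommGroup W] [Module k W] [Module B W]
    {c : (tensorFunctor k B W).obj (P.complex.X n)} {x : TorMod k A B T W n}
    (h : RepresentsTor A P n c x) (g : ModuleCat.of Bᵐᵒᵖ T ⟶ ModuleCat.of Bᵐᵒᵖ T) :
    RepresentsTor A P' n (tensorMap k ((ProjectiveResolution.lift g P P').f n) W c)
      ((((tensorFunctor k B W).leftDerived n).map g).hom x) := by
  obtain ⟨y, rfl, rfl⟩ := h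
  let φ := ProjectiveResolution.lift g P P'
  let ψ : tensorComplex k P W ⟶ tensorComplex k P' W :=
    ((tensorFunctor k B W).mapHomologicalComplex _).map φ
  refine ⟨(HomologicalComplex.cyclesMap ψ n).hom y, ?_, ?_⟩
  · exact congrArg (fun f => f.hom y) (HomologicalComplex.cyclesMap_i ψ n)
  · have h1 := congrArg (fun f => f.hom y) (HomologicalComplex.homologyπ_naturality ψ n)
    have h2 := congrArg (fun f => f.hom (((tensorComplex k P W).homologyπ n).hom y))
      (P.isoLeftDerivedObj_inv_naturality g P' φ (ProjectiveResolution.lift_commutes_zero g P P')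
        (tensorFunctor k B W) n)
    exact (congrArg (P'.isoLeftDerivedObj (tensorFunctor k B W) n).inv.hom h1.symm).trans h2.symm

variable [IsAlgClosed k] {Z : Scheme.{u}} {p : Z ⟶ Spec (.of k)}
  [LocallyOfFiniteType p] {W : closedPoints Z → Type u} [∀ z, AddCommGroup (W z)]
  [∀ z, Module k (W z)] [∀ z, Module B (W z)] {A : Type u}

/-- Regularity of a family of classes is preserved by the maps induced by endomorphisms of `T`,
and does not depend on the resolution. -/
lemma IsRegularTorFamily.map {E : AlgVectorBundle p W}
    {P P' : ProjectiveResolution (ModuleCat.of Bᵐᵒᵖ T)} {n : ℕ} {U : Z.Opens}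
    {s : ∀ z, TorMod k A B T (W z) n} (hs : IsRegularTorFamily E P n U s)
    (g : ModuleCat.of Bᵐᵒᵖ T ⟶ ModuleCat.of Bᵐᵒᵖ T) :
    IsRegularTorFamily (A := A) E P' n U
      (fun z => (((tensorFunctor k B (W z)).leftDerived n).map g).hom (s z)) := by
  intro z hz
  obtain ⟨U', hU', hzU', m, x, t, ht, hs⟩ := hs z hz
  -- Only the fixed elements `x_j` move, under a lift that is independent of `w`; the regular
  -- sections `t_j` are kept.
  refine ⟨U', hU', hzU', m, fun j => ((ProjectiveResolution.lift g P P').f n).hom (x j), t, ht,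
    fun w hw => ?_⟩
  have h := (hs w hw).map (P' := P') g
  rw [map_sum] at h
  exact h

lemma isRegularTorFamily_iff_of_resolutions {E : AlgVectorBundle p W}
    (P P' : ProjectiveResolution (ModuleCat.of Bᵐᵒᵖ T)) {n : ℕ} {U : Z.Opens}
    {s : ∀ z, TorMod k A B T (W z) n} :
    IsRegularTorFamily E P n U s ↔ IsRegularTorFamily E P' n U s := by
  have h (x : ∀ z, TorMod k A B T (W z) n) : (fun z =>
      (((tensorFunctor k B (W z)).leftDerived n).map (𝟙 (ModuleCat.of Bᵐᵒᵖ T))).hom (x z)) = x :=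
    funext fun z => congrArg (fun f => f.hom (x z))
      (((tensorFunctor k B (W z)).leftDerived n).map_id (ModuleCat.of Bᵐᵒᵖ T))
  exact ⟨fun hs => h s ▸ hs.map (P' := P') (𝟙 _), fun hs => h s ▸ hs.map (P' := P) (𝟙 _)⟩

variable [∀ z, IsScalarTower k B (W z)]

/-- Each entry is an entry of the action matrix of a fixed element of `B`, namely a coefficient of
`d` in the given bases. -/
lemma isRegularMatrix_tensorMap (E : ModuleFamily p B W) (i : E.index) {N N' : ModuleCat.{u} Bᵐᵒᵖ}
    {ι κ : Type} [Fintype ι] [Fintype κ] [DecidableEq ι] [DecidableEq κ]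
    (b : Module.Basis ι Bᵐᵒᵖ N) (b' : Module.Basis κ Bᵐᵒᵖ N') (d : N ⟶ N') :
    IsRegularMatrix p (E.chart i) fun z =>
      LinearMap.toMatrix (tensorBasis b (E.frame i z)) (tensorBasis b' (E.frame i z))
        (tensorMap k d (W z)) := by
  rintro ⟨i₁, c₁⟩ ⟨i₂, c₂⟩
  simp only [LinearMap.toMatrix_apply, tensorBasis_apply, tensorMap_balancedTmul, tensorBasis_repr]
  exact E.action _ i c₂ c₁

end TorClasses

/-! ### Part (2): Tor in families -/

section TorTheorem

variable {k : Type u} [Field k] [IsAlgClosed k] {A B T : Type u} [Ring A] [Algebra k A]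
  [Ring B] [Algebra k B] [Module.Finite k B]
  [AddCommGroup T] [Module k T] [Module.Finite k T] [Module A T] [Module Bᵐᵒᵖ T]
  [SMulCommClass A Bᵐᵒᵖ T] [IsScalarTower k A T] [IsScalarTower k Bᵐᵒᵖ T]
  {Z : Scheme.{u}} {p : Z ⟶ Spec (.of k)} [LocallyOfFiniteType p]

theorem exists_moduleFamily_tor (n : ℕ) (W : closedPoints Z → Type u) [∀ z, AddCommGroup (W z)]
    [∀ z, Module k (W z)] [∀ z, Module B (W z)] [∀ z, IsScalarTower k B (W z)]
    (E : ModuleFamily p B W)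
    (hE : ∀ l ≤ n, ∃ t : ℕ, ∀ z, Module.finrank k (TorMod k A B T (W z) l) = t) :
    ∃ F : ModuleFamily p A (fun z => TorMod k A B T (W z) n),
      ∀ P : ProjectiveResolution (ModuleCat.of Bᵐᵒᵖ T),
        ∀ (U : Z.Opens) (s : ∀ z, TorMod k A B T (W z) n),
          F.IsRegularSection U s ↔ IsRegularTorFamily E.toAlgVectorBundle P n U s := by
  have : IsNoetherianRing Bᵐᵒᵖ := IsNoetherianRing.of_finite k Bᵐᵒᵖ
  have : Module.Finite Bᵐᵒᵖ T := Module.Finite.of_restrictScalars_finite k Bᵐᵒᵖ T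
  let M := FGModuleCat.of Bᵐᵒᵖ T
  let Q : ProjectiveResolution (ModuleCat.of Bᵐᵒᵖ T) := FiniteFreeResolution.resolution M
  let bQ (l : ℕ) : Module.Basis _ Bᵐᵒᵖ (Q.complex.X l) := FiniteFreeResolution.resolutionBasis M l
  have hfin (z : closedPoints Z) (l : ℕ) :
      Module.finrank k ((tensorFunctor k B (W z)).obj (Q.complex.X l)) =
        FiniteFreeResolution.coverRank (FiniteFreeResolution.syzygy M l) * E.rank := by
    obtain ⟨i, -⟩ := E.covers z
    rw [Module.finrank_eq_card_basis (tensorBasis (bQ l) (E.frame i z))]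
    simp
  have hfinite (z : closedPoints Z) (l : ℕ) :
      Module.Finite k ((tensorFunctor k B (W z)).obj (Q.complex.X l)) := by
    obtain ⟨i, -⟩ := E.covers z
    exact Module.Finite.of_basis (tensorBasis (bQ l) (E.frame i z))
  have hrank : ∀ l ≤ n + 1, ∀ z w : closedPoints Z,
      Module.finrank k (LinearMap.range (tensorMap k (Q.complex.d l (l - 1)) (W z))) =
      Module.finrank k (LinearMap.range (tensorMap k (Q.complex.d l (l - 1)) (W w))) := by
    -- For Tor the incoming differential has index `l + 1` and the outgoing one index `l`, opposite
    -- to Ext; `add_right_comm` exchanges the two ranks.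
    refine rank_eq_of_recurrence (h := fun l z => Module.finrank k (TorMod k A B T (W z) l))
      (fun z => ?_) hE (fun l z => (add_right_comm _ _ _).trans
        ((isHomologyOf_torClass (A := A) Q l (W z)).finrank_add_rank_add_rank.trans (hfin z l)))
    have : tensorMap k (Q.complex.d 0 (0 - 1)) (W z) = 0 := by
      rw [Q.complex.shape _ _ (by simp), tensorMap, Functor.map_zero]
      rfl
    rw [this, LinearMap.range_zero, finrank_bot]
  obtain ⟨m, hm⟩ := hE n le_rfl
  suffices h : ∃ F : ModuleFamily p A (fun z => TorMod k A B T (W z) n), ∀ U s,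
      F.IsRegularSection U s ↔ IsRegularTorFamily E.toAlgVectorBundle Q n U s by
    obtain ⟨F, hF⟩ := h
    exact ⟨F, fun P U s => (hF U s).trans (isRegularTorFamily_iff_of_resolutions Q P)⟩
  refine exists_moduleFamily (fun U s => IsRegularTorFamily E.toAlgVectorBundle Q n U s)
    ?_ ?_ m ?_ ?_
  · intro U U₁ s hU hs z hz
    obtain ⟨U', hU', hz', r, x, t, ht, hst⟩ := hs z (hU hz)
    exact ⟨U' ⊓ U₁, inf_le_right, ⟨hz', hz⟩, r, x, t,
      fun j i a => (ht j i a).mono p (inf_le_inf_right _ inf_le_left), fun w hw => hst w hw.1⟩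
  · intro U s hs z hz
    obtain ⟨U₁, hU₁, hz₁, h⟩ := hs z hz
    obtain ⟨U', hU', hz', h'⟩ := h z hz₁
    exact ⟨U', hU'.trans hU₁, hz', h'⟩
  · intro z
    obtain ⟨i, hi⟩ := E.covers z
    obtain ⟨U₁, hU₁, hzU₁, e, he⟩ := exists_frame_of_isHomologyOf (p := p)
      (fun w => isHomologyOf_torClass (k := k) (A := A) Q n (W w))
      (fun w => tensorBasis (bQ (n + 1)) (E.frame i w)) (fun w => tensorBasis (bQ n) (E.frame i w))
      (fun w => tensorBasis (bQ (n - 1)) (E.frame i w)) (isRegularMatrix_tensorMap E i _ _ _)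
      (isRegularMatrix_tensorMap E i _ _ _) (hrank (n + 1) le_rfl) (hrank n (by omega)) hm z hi
    refine ⟨U₁, hzU₁, e, fun U hU s => ?_⟩
    rw [he U hU s]
    have hchart : ∀ {U' : Z.Opens}, U' ≤ U → U' ≤ E.chart i := fun h => h.trans (hU.trans hU₁)
    constructor
    · intro hs w hw
      obtain ⟨U', hU', hwU', r, x, t, ht, hst⟩ := hs w hw
      let c : ∀ w, (tensorFunctor k B (W w)).obj (Q.complex.X n) := fun w =>
        ∑ j, balancedTmul k B (W w) (Q.complex.X n) (x j) (t j w)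
      have hc : ∀ j, IsRegularOn p U' fun w => (tensorBasis (bQ n) (E.frame i w)).repr (c w) j := by
        rintro ⟨j, a⟩
        have h1 : (fun w => (tensorBasis (bQ n) (E.frame i w)).repr (c w) (j, a)) =
            ∑ l, fun w => (E.frame i w).repr (((bQ n).repr (x l) j).unop • t l w) a := by
          ext w
          simp only [c, map_sum, Finsupp.coe_finsetSum, Finset.sum_apply, tensorBasis_repr]
        rw [h1, ← mem_regularFunctions]
        exact sum_mem fun l _ => E.isRegularOn_smul (hchart hU') _ _
          ((E.isRegularSection_iff_of_le (hchart hU') _).1 (ht l)) a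
      classical
      -- On `U'` the element `c w` is a cycle; the default `0` can occur only outside.
      let f : ∀ w, LinearMap.ker (tensorMap k (Q.complex.d n (n - 1)) (W w)) := fun w =>
        if h : tensorMap k (Q.complex.d n (n - 1)) (W w) (c w) = 0 then ⟨c w, h⟩ else 0
      have hf : ∀ w : closedPoints Z, w.1 ∈ U' →
          (f w).1 = c w ∧ s w = torClass k A Q n (W w) (f w) := by
        intro w hw
        obtain ⟨h, hsw⟩ := (representsTor_iff Q n (c w) (s w)).1 (hst w hw)
        have hfw : f w = ⟨c w, h⟩ := dif_pos h
        rw [hfw]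
        exact ⟨rfl, hsw⟩
      refine ⟨U', hU', hwU', f, fun j => (hc j).congr p fun w hw => ?_, fun w hw => (hf w hw).2⟩
      rw [(hf w hw).1]
    · intro hs w hw
      obtain ⟨U', hU', hwU', f, hreg, hsf⟩ := hs w hw
      -- The `x_j` are the basis vectors of the free module `Q_n`, and `t_j` is the block of
      -- coordinates of the cycle belonging to the `j`-th one.
      refine ⟨U', hU', hwU', _, bQ n, fun j w => (E.frame i w).equivFun.symm fun a =>
        (tensorBasis (bQ n) (E.frame i w)).repr (f w).1 (j, a), fun j => ?_, fun w hw => ?_⟩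
      · rw [E.isRegularSection_iff_of_le (hchart hU')]
        intro a
        refine (hreg (j, a)).congr p fun w _ => ?_
        exact (congrFun ((E.frame i w).equivFun.apply_symm_apply fun a =>
          (tensorBasis (bQ n) (E.frame i w)).repr (f w).1 (j, a)) a).symm
      · have h : (∑ j, balancedTmul k B (W w) (Q.complex.X n) (bQ n j)
            ((E.frame i w).equivFun.symm fun a =>
              (tensorBasis (bQ n) (E.frame i w)).repr (f w).1 (j, a))) = (f w).1 :=
          (tensorOfCoords_apply (bQ n) (E.frame i w) _).symm.trans
            ((tensorBasis (bQ n) (E.frame i w)).equivFun.symm_apply_apply (f w).1)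
        rw [h, representsTor_iff]
        exact ⟨(f w).2, hsf w hw⟩
  · intro a U s hs
    -- The action of `a` on Tor is by definition the map induced by left multiplication on `T`.
    exact hs.map (leftMulHom B T a)

end TorTheorem

end

theorem lemma3p1 {k : Type u} [Field k] [IsAlgClosed k]
    {A B T : Type u} [Ring A] [Algebra k A] [Module.Finite k A]
    [Ring B] [Algebra k B] [Module.Finite k B]
    [AddCommGroup T] [Module k T] [Module.Finite k T] [Module A T] [Module Bᵐᵒᵖ T]
    [SMulCommClass A Bᵐᵒᵖ T] [IsScalarTower k A T] [IsScalarTower k Bᵐᵒᵖ T]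
    {Z : Scheme.{u}} (p : Z ⟶ Spec (.of k)) [IsReduced Z] [IsSeparated p]
    [LocallyOfFiniteType p] [QuasiCompact p] (n : ℕ) :
    (∀ (V : closedPoints Z → Type u) [∀ z, AddCommGroup (V z)] [∀ z, Module k (V z)]
        [∀ z, Module A (V z)] [∀ z, IsScalarTower k A (V z)] (E : ModuleFamily p A V),
      (∀ l ≤ n, ∃ m : ℕ, ∀ z, Module.finrank k (ExtMod A B T (V z) l) = m) →
      ∃ F : ModuleFamily p B (fun z => ExtMod A B T (V z) n),
        ∀ P : ProjectiveResolution (ModuleCat.of A T),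
          (∀ i, Module.Finite A (P.complex.X i)) →
          ∀ (U : Z.Opens) (s : ∀ z, ExtMod A B T (V z) n),
            F.IsRegularSection U s ↔ IsRegularExtFamily E.toAlgVectorBundle P n U s) ∧
    (∀ (W : closedPoints Z → Type u) [∀ z, AddCommGroup (W z)] [∀ z, Module k (W z)]
        [∀ z, Module B (W z)] [∀ z, IsScalarTower k B (W z)] (E : ModuleFamily p B W),
      (∀ l ≤ n, ∃ t : ℕ, ∀ z, Module.finrank k (TorMod k A B T (W z) l) = t) →
      ∃ F : ModuleFamily p A (fun z => TorMod k A B T (W z) n),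
        ∀ P : ProjectiveResolution (ModuleCat.of Bᵐᵒᵖ T),
          (∀ i, Module.Finite Bᵐᵒᵖ (P.complex.X i)) →
          ∀ (U : Z.Opens) (s : ∀ z, TorMod k A B T (W z) n),
            F.IsRegularSection U s ↔ IsRegularTorFamily E.toAlgVectorBundle P n U s) :=
  ⟨fun V _ _ _ _ E hE =>
      let ⟨F, hF⟩ := exists_moduleFamily_ext n V E hE
      ⟨F, fun P _ => hF P⟩,
    fun W _ _ _ _ E hE =>
      let ⟨F, hF⟩ := exists_moduleFamily_tor n W E hE
      ⟨F, fun P _ => hF P⟩⟩
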